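/- Let $(\bar M,g,J)$ be a Kaehler manifold of real dimension $m+2n$ with Levi-Civita connection $\bar\nabla$ (so $J^2=-I$, $g(JX,JY)=g(X,Y)$, $\bar\nabla J=0$). Let $(M_T,g_1)$ and $(M_\theta,g_2)$ be Riemannian manifolds of dimensions $m$ and $n$, let $f:M_T\to(0,\infty)$ be a non-constant smooth function, and let $M=M_T\times_f M_\theta$ be the (non-trivial) warped product, that is, $M_T\times M_\theta$ with the metric $\pi^*g_1+(f\circ\pi)^2\,\eta^*g_2$, where $\pi,\eta$ are the two projections. Let $M$ be isometrically immersed in $\bar M$, with second fundamental form $h$, so that - each leaf $M_T\times\{q\}$ is a holomorphic submanifold of $\bar M$, i.e. its tangent spaces are invariant under $J$; - each leaf $\{p\}\times M_\theta$ is a proper pointwise slant submanifold of $\bar M$: at each of its points $x$ the angle between $JX$ and the tangent space of the leaf has the same value $\theta(x)$ for all nonzero vectors $X$ tangent to the leaf at $x$, and $\cos\theta(x)\neq 0$. All manifolds and maps are smooth. Then: (i) At every point of $M$ with $\sin\theta\neq0$ (so that $\csc\theta$ and $\cot\theta$ are defined), $$\|h\|^2\;\ge\;2n\,(\csc^2\theta+\cot^2\theta)\,\|\nabla\ln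 f\|^2 ,$$ where $\|h\|^2=\sum_{i,j}\|h(e_i,e_j)\|^2$ for an orthonormal basis $(e_i)$ of the tangent space of $M$, and $\nabla\ln f$ is the gradient of $\ln (f\circ\pi)$ on $M$. (ii) If $\sin\theta\ne0$ on all of $M$ and equality holds in (i) at every point of $M$, then every leaf $M_T\times\{q\}$ is a totally geodesic submanifold of $\bar M$, every leaf $\{p\}\times M_\theta$ is a totally umbilical submanifold of $\bar M$, and $M$ is a minimal submanifold of $\bar M$. -/

import Mathlib

open Bundle Manifold
open scoped ContDiff

noncomputable section

section Ambient

variable {E : Type*} [NormedAddCommGroup E] [NormedSpace ℝ E] [FiniteDimensional ℝ E]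
  {H : Type*} [TopologicalSpace H] {I : ModelWithCorners ℝ E H}
  {N : Type*} [TopologicalSpace N] [ChartedSpace H N]

instance instFiniteDimensionalTangentSpace (x : N) : FiniteDimensional ℝ (TangentSpace I x) :=
  inferInstanceAs (FiniteDimensional ℝ E)

variable [RiemannianBundle (fun x : N => TangentSpace I x)]

instance instCompleteTangentSpace (x : N) : CompleteSpace (TangentSpace I x) :=
  FiniteDimensional.complete ℝ (TangentSpace I x)

variable [IsManifold I ∞ N]
  [IsContMDiffRiemannianBundle I ∞ E (fun x : N => TangentSpace I x)]

/-- `cov` is the Levi-Civita connection of the Riemannian manifold `N`: it is torsion free and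
compatible with the metric, `v g(Y, Z) = g(∇_v Y, Z) + g(Y, ∇_v Z)`. (`cov Y x v` stands for `∇_v Y` at `x`.) -/
structure IsLeviCivita (cov : CovariantDerivative I E (TangentSpace I : N → Type _)) : Prop where
  torsion_eq_zero : cov.torsion = 0
  metric (Y Z : ∀ x : N, TangentSpace I x) (x : N)
    (hY : MDifferentiableAt I (I.prod 𝓘(ℝ, E)) (fun x => (⟨x, Y x⟩ : TangentBundle I N)) x)
    (hZ : MDifferentiableAt I (I.prod 𝓘(ℝ, E)) (fun x => (⟨x, Z x⟩ : TangentBundle I N)) x)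
    (v : TangentSpace I x) :
    mvfderiv I (fun y => (inner ℝ (Y y) (Z y) : ℝ)) x v
      = inner ℝ (cov Y x v) (Z x) + inner ℝ (Y x) (cov Z x v)

/-- `(N, g, J)` is a Kaehler manifold, `cov` being the Levi-Civita connection of `g`: `J` is a
smooth tensor field of type (1,1) with `J² = -1`, `g(JX, JY) = g(X, Y)` and `∇J = 0`. -/
structure IsKaehler (cov : CovariantDerivative I E (TangentSpace I : N → Type _))
    (J : ∀ x : N, TangentSpace I x →L[ℝ] TangentSpace I x) : Prop where
  leviCivita : IsLeviCivita cov
  smooth : ContMDiff I (I.prod 𝓘(ℝ, E →L[ℝ] E)) ∞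
    (fun x => TotalSpace.mk' (E →L[ℝ] E)
      (E := fun x : N => TangentSpace I x →L[ℝ] TangentSpace I x) x (J x))
  sq (x : N) (v : TangentSpace I x) : J x (J x v) = -v
  isometry (x : N) (v w : TangentSpace I x) : inner ℝ (J x v) (J x w) = inner ℝ v w
  parallel (Y : ∀ x : N, TangentSpace I x) (x : N)
    (hY : MDifferentiableAt I (I.prod 𝓘(ℝ, E)) (fun x => (⟨x, Y x⟩ : TangentBundle I N)) x)
    (v : TangentSpace I x) : cov (fun y => J y (Y y)) x v = J x (cov Y x v)

end Ambient

section Gradient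

variable {E : Type*} [NormedAddCommGroup E] [NormedSpace ℝ E] [FiniteDimensional ℝ E]
  {H : Type*} [TopologicalSpace H] (I : ModelWithCorners ℝ E H)
  {M : Type*} [TopologicalSpace M] [ChartedSpace H M]
  [RiemannianBundle (fun x : M => TangentSpace I x)]

/-- The gradient of a function `u` on a Riemannian manifold: `g(∇u, v) = du(v)`. -/
def riemannianGradient (u : M → ℝ) (x : M) : TangentSpace I x :=
  (InnerProductSpace.toDual ℝ (TangentSpace I x)).symm (mvfderiv I u x)

end Gradient

section Submanifold

variable {E : Type*} [NormedAddCommGroup E] [NormedSpace ℝ E] [FiniteDimensional ℝ E]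
  {H : Type*} [TopologicalSpace H] {I : ModelWithCorners ℝ E H}
  {N : Type*} [TopologicalSpace N] [ChartedSpace H N] [IsManifold I ∞ N]
  {F : Type*} [NormedAddCommGroup F] [NormedSpace ℝ F] [FiniteDimensional ℝ F]
  {G : Type*} [TopologicalSpace G] (K : ModelWithCorners ℝ F G)
  {M : Type*} [TopologicalSpace M] [ChartedSpace G M] [IsManifold K ∞ M]

/-- The connection along a map `φ : M → N` (the pull-back of the connection `cov` of `N`): the
derivative `∇_v W` at `p` of a vector field `W` along `φ`, in the direction `v ∈ T_p M`. In the
frame `(eᵢ)` of `TN` over a neighbourhood of `φ p` that is given by the trivialization at `φ p`,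
one has `W = ∑ Wⁱ eᵢ ∘ φ` and `∇_v W = ∑ dWⁱ(v) eᵢ + ∑ Wⁱ(p) ∇_{dφ v} eᵢ`. -/
def covAlong (cov : CovariantDerivative I E (TangentSpace I : N → Type _)) (φ : M → N)
    (W : ∀ p : M, TangentSpace I (φ p)) (p : M) (v : TangentSpace K p) : TangentSpace I (φ p) :=
  (trivializationAt E (TangentSpace I : N → Type _) (φ p)).symm (φ p)
      (mvfderiv K (fun q => ((trivializationAt E (TangentSpace I : N → Type _) (φ p))
        (⟨φ q, W q⟩ : TangentBundle I N)).2) p v)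
    + cov (FiberBundle.extend E (W p)) (φ p) (mfderiv K I φ p v)

/-- The tangent space `dφ (T_p M)` of an immersed submanifold `φ : M → N`, as a subspace of
`T_{φ p} N`. -/
def tangentImage (φ : M → N) (p : M) : Submodule ℝ (TangentSpace I (φ p)) :=
  LinearMap.range (mfderiv K I φ p : TangentSpace K p →ₗ[ℝ] TangentSpace I (φ p))

variable [RiemannianBundle (fun x : N => TangentSpace I x)]

/-- The tangential component of a vector of `T_{φ p} N`. -/
def tangentialPart (φ : M → N) (p : M) (u : TangentSpace I (φ p)) : TangentSpace I (φ p) :=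
  (tangentImage (I := I) K φ p).starProjection u

/-- The normal component of a vector of `T_{φ p} N`. -/
def normalPart (φ : M → N) (p : M) (u : TangentSpace I (φ p)) : TangentSpace I (φ p) :=
  u - tangentialPart (I := I) K φ p u

/-- The second fundamental form `h(v, w)` of an immersed submanifold `φ : M → N`: the normal
component of `∇_v (dφ Y)`, for a local vector field `Y` on `M` that extends `w`. -/
def secondFundamentalForm (cov : CovariantDerivative I E (TangentSpace I : N → Type _))
    (φ : M → N) (p : M) (v w : TangentSpace K p) : TangentSpace I (φ p) :=
  normalPart K φ p
    (covAlong K cov φ (fun q => mfderiv K I φ q (FiberBundle.extend F w q)) p v)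

/-- A totally geodesic submanifold: `h = 0`. -/
def IsTotallyGeodesicSubmanifold (cov : CovariantDerivative I E (TangentSpace I : N → Type _))
    (φ : M → N) : Prop :=
  ∀ (p : M) (v w : TangentSpace K p), secondFundamentalForm K cov φ p v w = 0

/-- A totally umbilical submanifold: `h(v, w) = g(v, w) H` for a normal vector `H` at each point,
`g` being the induced metric. -/
def IsTotallyUmbilicalSubmanifold (cov : CovariantDerivative I E (TangentSpace I : N → Type _))
    (φ : M → N) : Prop :=
  ∀ p : M, ∃ η ∈ (tangentImage (I := I) K φ p)ᗮ, ∀ v w : TangentSpace K p,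
    secondFundamentalForm K cov φ p v w
      = (inner ℝ (mfderiv K I φ p v) (mfderiv K I φ p w) : ℝ) • η

/-- A holomorphic submanifold: `J (T_p M) ⊆ T_p M`. -/
def IsHolomorphicSubmanifold (J : ∀ x : N, TangentSpace I x →L[ℝ] TangentSpace I x)
    (φ : M → N) : Prop :=
  ∀ (p : M), ∀ u ∈ tangentImage (I := I) K φ p, J (φ p) u ∈ tangentImage (I := I) K φ p

/-- A pointwise slant submanifold with slant function `θ`: at every point `p`, the angle between
`J X` and the subspace `T_p M` is `θ p` for every nonzero `X ∈ T_p M`. (The angle between a nonzero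
vector and a subspace is the angle with its orthogonal projection, `π / 2` if that is zero.) -/
def IsPointwiseSlant (J : ∀ x : N, TangentSpace I x →L[ℝ] TangentSpace I x)
    (φ : M → N) (θ : M → ℝ) : Prop :=
  ∀ (p : M), ∀ u ∈ tangentImage (I := I) K φ p, u ≠ 0 →
    InnerProductGeometry.angle (J (φ p) u) (tangentialPart K φ p (J (φ p) u)) = θ p

/-- A proper pointwise slant submanifold: pointwise slant, without totally real points. -/
structure IsProperPointwiseSlant (J : ∀ x : N, TangentSpace I x →L[ℝ] TangentSpace I x)
    (φ : M → N) (θ : M → ℝ) : Prop where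
  slant : IsPointwiseSlant K J φ θ
  not_totallyReal (p : M) : Real.cos (θ p) ≠ 0

variable [RiemannianBundle (fun p : M => TangentSpace K p)]

/-- `φ : M → N` is a (smooth) isometric immersion. -/
structure IsIsometricImmersion (φ : M → N) : Prop where
  smooth : ContMDiff K I ∞ φ
  isometric (p : M) (v w : TangentSpace K p) :
    inner ℝ (mfderiv K I φ p v) (mfderiv K I φ p w) = inner ℝ v w

/-- `‖h‖² = ∑ ‖h(eᵢ, eⱼ)‖²` over an orthonormal basis of `T_p M`. -/
def secondFundamentalFormNormSq (cov : CovariantDerivative I E (TangentSpace I : N → Type _))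
    (φ : M → N) (p : M) : ℝ :=
  ∑ i, ∑ j, ‖secondFundamentalForm K cov φ p (stdOrthonormalBasis ℝ (TangentSpace K p) i)
    (stdOrthonormalBasis ℝ (TangentSpace K p) j)‖ ^ 2

/-- The mean curvature vector `(1 / dim M) ∑ h(eᵢ, eᵢ)`, over an orthonormal basis of `T_p M`. -/
def meanCurvatureVector (cov : CovariantDerivative I E (TangentSpace I : N → Type _))
    (φ : M → N) (p : M) : TangentSpace I (φ p) :=
  (1 / (Module.finrank ℝ F : ℝ)) •
    ∑ i, secondFundamentalForm K cov φ p (stdOrthonormalBasis ℝ (TangentSpace K p) i)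
      (stdOrthonormalBasis ℝ (TangentSpace K p) i)

/-- A minimal submanifold: the mean curvature vector vanishes. -/
def IsMinimalSubmanifold (cov : CovariantDerivative I E (TangentSpace I : N → Type _))
    (φ : M → N) : Prop :=
  ∀ p : M, meanCurvatureVector K cov φ p = 0

end Submanifold

section Warped

variable {E₁ : Type*} [NormedAddCommGroup E₁] [NormedSpace ℝ E₁]
  {H₁ : Type*} [TopologicalSpace H₁] (I₁ : ModelWithCorners ℝ E₁ H₁)
  {B : Type*} [TopologicalSpace B] [ChartedSpace H₁ B]
  [RiemannianBundle (fun x : B => TangentSpace I₁ x)]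
  {E₂ : Type*} [NormedAddCommGroup E₂] [NormedSpace ℝ E₂]
  {H₂ : Type*} [TopologicalSpace H₂] (I₂ : ModelWithCorners ℝ E₂ H₂)
  {F : Type*} [TopologicalSpace F] [ChartedSpace H₂ F]
  [RiemannianBundle (fun x : F => TangentSpace I₂ x)]
  [RiemannianBundle (fun x : B × F => TangentSpace (I₁.prod I₂) x)]

/-- The Riemannian structure of `B × F` is that of the warped product `B ×_f F`:
`f : B → (0, ∞)` is smooth and
`g(X, Y) = g₁(π_* X, π_* Y) + (f ∘ π)² g₂(η_* X, η_* Y)` for the projections `π` and `η`. -/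
structure IsWarpedProduct (f : B → ℝ) : Prop where
  smooth : ContMDiff I₁ 𝓘(ℝ) ∞ f
  pos (b : B) : 0 < f b
  metric (x : B × F) (v w : TangentSpace (I₁.prod I₂) x) :
    inner ℝ v w =
      inner ℝ (mfderiv (I₁.prod I₂) I₁ Prod.fst x v) (mfderiv (I₁.prod I₂) I₁ Prod.fst x w)
      + f x.1 ^ 2 *
        inner ℝ (mfderiv (I₁.prod I₂) I₂ Prod.snd x v) (mfderiv (I₁.prod I₂) I₂ Prod.snd x w)

end Warped

end

/-!
Write `∇` for the connection along the immersion `φ` and `B v w = ∇_v (dφ w)` for coordinate fields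
`w` on the product; `h` is the normal part of `B`. Since the Levi-Civita connection of the ambient
manifold is metric and torsion free, `B` is a symmetric bilinear map at each point and the Koszul
formula computes its tangential part from the metric of the warped product. For `X`, `Y` tangent to
`M_T`, and `Z`, `W` tangent to `M_θ`, this gives
`⟨B X Z, W⟩ = (X ln f) ⟨Z, W⟩`, `⟨B Z W, X⟩ = -(X ln f) ⟨Z, W⟩` and `⟨B X Y, W⟩ = 0`
(`inner_covAlong_left_right_right`, `inner_covAlong_right_right_left`,
`inner_covAlong_left_left_right`).

As `M_T` is holomorphic, `⟨JX, W⟩ = 0`. Differentiating along `Z`, with `J` parallel, gives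
`⟨B X Z, JW⟩ = -(JX ln f) ⟨Z, W⟩` (`inner_covAlong_left_right_J`). Decompose `JW = QW + FW` into its
component tangent to the leaf `M_θ` and the rest, which is normal to `M`. The slant condition says that
`|FW| = sin θ |W|` and `|QW| = cos θ |W|`, so `FW / sin θ` runs through an orthonormal family of
normal vectors when `W` runs through an orthonormal basis, and
`⟨h(X, Z), FW⟩ = -(JX ln f) ⟨Z, W⟩ - (X ln f) ⟨Z, QW⟩`. Bessel's inequality, summed over orthonormal
bases, bounds the mixed part of `‖h‖²` from below by `n (csc² θ + cot² θ) ‖∇ ln f‖²`: the cross terms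
vanish because `⟨Z, QZ⟩ = 0` (`mixed_sum_norm_sq_le`). The mixed part occurs twice in `‖h‖²`, which is
the inequality (`le_secondFundamentalFormNormSq`).

In the case of equality, `h` vanishes on pairs of vectors tangent to the same factor. Its trace is then
zero, and the second fundamental forms of the leaves in the ambient manifold are those of the leaves
in the warped product, where the leaves `M_T` are totally geodesic and the leaves `M_θ` totally
umbilical with normal curvature vector `-∇ ln f` (`secondFundamentalForm_leaf_left`,
`secondFundamentalForm_leaf_right`).
-/

noncomputable section

/-! ### Orthonormal bases and the linear algebra of the estimate -/

section LinearAlgebra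

variable {V U : Type*} [NormedAddCommGroup V] [InnerProductSpace ℝ V] [FiniteDimensional ℝ V]
  [NormedAddCommGroup U] [InnerProductSpace ℝ U]

lemma sum_norm_sq_map_eq_trace {α : Type*} [Fintype α] (b : OrthonormalBasis α ℝ V)
    (A : V →ₗ[ℝ] U) :
    ∑ i, ‖A (b i)‖ ^ 2 = LinearMap.trace ℝ V
      (LinearMap.adjoint A.rangeRestrict ∘ₗ A.rangeRestrict) := by
  rw [LinearMap.trace_eq_sum_inner _ b]
  refine Finset.sum_congr rfl fun i _ => ?_
  rw [LinearMap.comp_apply, LinearMap.adjoint_inner_right, real_inner_self_eq_norm_sq]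
  rfl

/-- The Hilbert-Schmidt norm of a linear map does not depend on the orthonormal basis. -/
lemma sum_norm_sq_map_orthonormalBasis {α β : Type*} [Fintype α] [Fintype β]
    (b : OrthonormalBasis α ℝ V) (c : OrthonormalBasis β ℝ V) (A : V →ₗ[ℝ] U) :
    ∑ i, ‖A (b i)‖ ^ 2 = ∑ j, ‖A (c j)‖ ^ 2 := by
  rw [sum_norm_sq_map_eq_trace, sum_norm_sq_map_eq_trace]

/-- The double sum of the squared norms of a bilinear map over an orthonormal basis does not depend
on the basis. -/
lemma sum_sum_norm_sq_orthonormalBasis {α β : Type*} [Fintype α] [Fintype β]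
    (b : OrthonormalBasis α ℝ V) (c : OrthonormalBasis β ℝ V) (A : V →ₗ[ℝ] V →ₗ[ℝ] U) :
    ∑ i, ∑ j, ‖A (b i) (b j)‖ ^ 2 = ∑ i, ∑ j, ‖A (c i) (c j)‖ ^ 2 := by
  calc ∑ i, ∑ j, ‖A (b i) (b j)‖ ^ 2 = ∑ i, ∑ j, ‖A (b i) (c j)‖ ^ 2 :=
        Finset.sum_congr rfl fun i _ => sum_norm_sq_map_orthonormalBasis b c (A (b i))
    _ = ∑ j, ∑ i, ‖A.flip (c j) (b i)‖ ^ 2 := Finset.sum_comm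
    _ = ∑ j, ∑ i, ‖A.flip (c j) (c i)‖ ^ 2 :=
        Finset.sum_congr rfl fun j _ => sum_norm_sq_map_orthonormalBasis b c (A.flip (c j))
    _ = _ := Finset.sum_comm

omit [FiniteDimensional ℝ V] in
/-- The trace of a bilinear map over an orthonormal basis does not depend on the basis. -/
lemma sum_diag_orthonormalBasis {α β : Type*} [Fintype α] [Fintype β]
    (b : OrthonormalBasis α ℝ V) (c : OrthonormalBasis β ℝ V) (A : V →ₗ[ℝ] V →ₗ[ℝ] U) :
    ∑ i, A (b i) (b i) = ∑ j, A (c j) (c j) := by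
  have h1 : ∀ i, A (b i) (b i) = ∑ j, ∑ k, (inner ℝ (c j) (b i) * inner ℝ (b i) (c k) : ℝ) •
      A (c j) (c k) := by
    intro i
    conv_lhs => rw [← c.sum_repr' (b i)]
    simp only [map_sum, map_smul, LinearMap.sum_apply, LinearMap.smul_apply, Finset.smul_sum,
      smul_smul]
    rw [Finset.sum_comm]
    refine Finset.sum_congr rfl fun j _ => Finset.sum_congr rfl fun k _ => ?_
    rw [real_inner_comm (c k), mul_comm]
  simp_rw [h1]
  rw [Finset.sum_comm]
  refine Finset.sum_congr rfl fun j _ => ?_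
  rw [Finset.sum_comm]
  simp_rw [← Finset.sum_smul, b.sum_inner_mul_inner]
  rw [Finset.sum_eq_single j]
  · rw [real_inner_self_eq_norm_sq, c.orthonormal.1 j]; simp
  · intro k _ hk
    rw [c.orthonormal.2 hk.symm, zero_smul]
  · simp

omit [FiniteDimensional ℝ V] in
/-- Orthonormal bases of two complementary orthogonal subspaces join to an orthonormal basis. -/
lemma exists_orthonormalBasis_sum {T S : Submodule ℝ V}
    (hTS : ∀ x ∈ T, ∀ z ∈ S, inner ℝ x z = (0 : ℝ)) (hsup : T ⊔ S = ⊤)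
    {α β : Type*} [Fintype α] [Fintype β]
    (a : OrthonormalBasis α ℝ T) (b : OrthonormalBasis β ℝ S) :
    ∃ c : OrthonormalBasis (α ⊕ β) ℝ V,
      (∀ i, c (Sum.inl i) = a i) ∧ ∀ j, c (Sum.inr j) = b j := by
  have hon : Orthonormal ℝ (Sum.elim (fun i => (a i : V)) (fun j => (b j : V))) := by
    refine ⟨?_, ?_⟩
    · rintro (i | j)
      · exact a.orthonormal.1 i
      · exact b.orthonormal.1 j
    · rintro (i | j) (k | l) h
      · exact a.orthonormal.2 (fun h' => h (by rw [h']))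
      · exact hTS _ (a i).2 _ (b l).2
      · rw [real_inner_comm]; exact hTS _ (a k).2 _ (b j).2
      · exact b.orthonormal.2 (fun h' => h (by rw [h']))
  have hsp : ⊤ ≤ Submodule.span ℝ
      (Set.range (Sum.elim (fun i => (a i : V)) (fun j => (b j : V)))) := by
    rw [← hsup, Set.Sum.elim_range, Submodule.span_union]
    refine sup_le_sup ?_ ?_
    · have := congrArg (Submodule.map T.subtype) a.toBasis.span_eq
      rw [Submodule.map_span, Submodule.map_top, Submodule.range_subtype, ← Set.range_comp] at this
      refine this.symm.le.trans ?_
      exact Submodule.span_mono (by rintro _ ⟨i, rfl⟩; exact ⟨i, by simp⟩)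
    · have := congrArg (Submodule.map S.subtype) b.toBasis.span_eq
      rw [Submodule.map_span, Submodule.map_top, Submodule.range_subtype, ← Set.range_comp] at this
      refine this.symm.le.trans ?_
      exact Submodule.span_mono (by rintro _ ⟨i, rfl⟩; exact ⟨i, by simp⟩)
  exact ⟨OrthonormalBasis.mk hon hsp, fun i => by simp, fun j => by simp⟩

omit [FiniteDimensional ℝ V] in
lemma OrthonormalBasis.sum_inner_sq_of_mem {T : Submodule ℝ V} {α : Type*} [Fintype α]
    (a : OrthonormalBasis α ℝ T) {t : V} (ht : t ∈ T) :
    ∑ i, (inner ℝ (a i : V) t : ℝ) ^ 2 = ‖t‖ ^ 2 := by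
  have := a.sum_sq_norm_inner_right (⟨t, ht⟩ : T)
  simpa using this

/-- The mixed part of the estimate. The vectors `J ι w - Q (J ι w)`, `w ∈ S`, where `Q` is the
projection onto `ι S`, are normal to `ι V` and `w ↦ (J ι w - Q (J ι w)) / sin θ` is isometric. Bessel's
inequality for the resulting orthonormal family bounds `‖H(x, z)‖²` below, and the cross terms of the
sum cancel because `z ↦ Q (J ι z)` is skew. -/
theorem mixed_sum_norm_sq_le [FiniteDimensional ℝ U] {T S : Submodule ℝ V}
    (hTS : ∀ x ∈ T, ∀ z ∈ S, inner ℝ x z = (0 : ℝ)) (hsup : T ⊔ S = ⊤)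
    {α β : Type*} [Fintype α] [Fintype β]
    (a : OrthonormalBasis α ℝ T) (b : OrthonormalBasis β ℝ S)
    (ι : V →ₗ[ℝ] U) (hι : ∀ v w, inner ℝ (ι v) (ι w) = (inner ℝ v w : ℝ))
    (J : U →ₗ[ℝ] U) (hJ2 : ∀ u, J (J u) = -u)
    (hJ : ∀ u v, inner ℝ (J u) (J v) = (inner ℝ u v : ℝ))
    (hJT : ∀ x ∈ T, ∃ y ∈ T, J (ι x) = ι y)
    {c s : ℝ} (hcs : s ^ 2 + c ^ 2 = 1) (hs : s ≠ 0)
    (hslant : ∀ z ∈ S, ‖(S.map ι).starProjection (J (ι z))‖ ^ 2 = c ^ 2 * ‖z‖ ^ 2)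
    (B : V →ₗ[ℝ] V →ₗ[ℝ] U) {t : V} (ht : t ∈ T)
    (hmix : ∀ x ∈ T, ∀ z ∈ S, ∀ w ∈ S,
      inner ℝ (B x z) (ι w) = (inner ℝ x t * inner ℝ z w : ℝ))
    (hmixJ : ∀ x ∈ T, ∀ y ∈ T, J (ι x) = ι y → ∀ z ∈ S, ∀ w ∈ S,
      inner ℝ (B x z) (J (ι w)) = (-(inner ℝ y t) * inner ℝ z w : ℝ)) :
    (Fintype.card β : ℝ) * ((1 / s) ^ 2 + (c / s) ^ 2) * ‖t‖ ^ 2 ≤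
      ∑ i, ∑ k, ‖B (a i) (b k) - (LinearMap.range ι).starProjection (B (a i) (b k))‖ ^ 2 := by
  have hskew : ∀ u v, inner ℝ (J u) v = (-(inner ℝ u (J v)) : ℝ) := by
    intro u v
    rw [← hJ u (J v), hJ2, inner_neg_right, neg_neg]
  set Q : U →ₗ[ℝ] U := ((S.map ι).starProjection : U →ₗ[ℝ] U) ∘ₗ J with hQ
  have hQmem : ∀ u, Q u ∈ S.map ι := fun u => Submodule.starProjection_apply_mem _ _
  have hQorth : ∀ u, ∀ z ∈ S, inner ℝ (J u - Q u) (ι z) = (0 : ℝ) := by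
    intro u z hz
    exact Submodule.starProjection_inner_eq_zero _ _ (Submodule.mem_map_of_mem hz)
  -- The normal vector field `F w = J ι w - Q ι w`.
  set F : V →ₗ[ℝ] U := (J - Q) ∘ₗ ι with hF
  have hFapp : ∀ w, F w = J (ι w) - Q (ι w) := fun w => rfl
  have hdec : ∀ v : V, ∃ x ∈ T, ∃ z ∈ S, v = x + z := by
    intro v
    obtain ⟨x, hx, z, hz, h⟩ := Submodule.mem_sup.1 (hsup ▸ Submodule.mem_top : v ∈ T ⊔ S)
    exact ⟨x, hx, z, hz, h.symm⟩
  have hFn : ∀ w ∈ S, ∀ u ∈ LinearMap.range ι, inner ℝ u (F w) = (0 : ℝ) := by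
    rintro w hw _ ⟨v, rfl⟩
    obtain ⟨x, hx, z, hz, rfl⟩ := hdec v
    rw [map_add, inner_add_left]
    have h1 : inner ℝ (ι z) (F w) = (0 : ℝ) := by rw [real_inner_comm]; exact hQorth _ z hz
    have h2 : inner ℝ (ι x) (F w) = (0 : ℝ) := by
      obtain ⟨y, hy, hxy⟩ := hJT x hx
      obtain ⟨w', hw', hw''⟩ := hQmem (ι w)
      rw [hFapp, inner_sub_right, ← hw'', hι, hTS x hx w' hw', ← neg_neg (inner ℝ (ι x) _),
        ← hskew, hxy, hι, hTS y hy w hw]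
      simp
    rw [h1, h2, add_zero]
  have hFnorm : ∀ w ∈ S, ‖F w‖ ^ 2 = s ^ 2 * ‖w‖ ^ 2 := by
    intro w hw
    obtain ⟨w', hw', hw''⟩ := hQmem (ι w)
    have h1 : ‖J (ι w)‖ ^ 2 = ‖w‖ ^ 2 := by
      rw [← real_inner_self_eq_norm_sq, hJ, hι, real_inner_self_eq_norm_sq]
    have h2 : ‖J (ι w)‖ ^ 2 = ‖F w‖ ^ 2 + ‖Q (ι w)‖ ^ 2 := by
      have h3 : inner ℝ (F w) (Q (ι w)) = (0 : ℝ) := by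
        rw [← hw'']; exact hQorth _ w' hw'
      have h4 : J (ι w) = F w + Q (ι w) := by rw [hFapp]; abel
      rw [h4, ← real_inner_self_eq_norm_sq, inner_add_left, inner_add_right, inner_add_right,
        real_inner_comm (F w) (Q (ι w)), h3, real_inner_self_eq_norm_sq, real_inner_self_eq_norm_sq]
      ring
    have h5 : ‖Q (ι w)‖ ^ 2 = c ^ 2 * ‖w‖ ^ 2 := hslant w hw
    have h6 : s ^ 2 = 1 - c ^ 2 := by linarith
    rw [h6]; linarith
  have hFinner : ∀ w ∈ S, ∀ w' ∈ S, inner ℝ (F w) (F w') = (s ^ 2 * inner ℝ w w' : ℝ) := by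
    intro w hw w' hw'
    rw [real_inner_eq_norm_add_mul_self_sub_norm_mul_self_sub_norm_mul_self_div_two,
      real_inner_eq_norm_add_mul_self_sub_norm_mul_self_sub_norm_mul_self_div_two, ← map_add]
    simp only [← sq]
    rw [hFnorm _ (S.add_mem hw hw'), hFnorm _ hw, hFnorm _ hw']
    ring
  have hon : Orthonormal ℝ (fun k => s⁻¹ • F (b k)) := by
    classical
    rw [orthonormal_iff_ite]
    intro k l
    rw [real_inner_smul_left, real_inner_smul_right, hFinner _ (b k).2 _ (b l).2,
      ← Submodule.coe_inner, orthonormal_iff_ite.1 b.orthonormal k l]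
    split_ifs
    · field_simp
    · simp
  -- Bessel's inequality.
  have hbessel : ∀ x ∈ T, ∀ z ∈ S, (s⁻¹) ^ 2 * ∑ l, (inner ℝ (B x z) (F (b l)) : ℝ) ^ 2 ≤
      ‖B x z - (LinearMap.range ι).starProjection (B x z)‖ ^ 2 := by
    intro x hx z hz
    have := hon.sum_inner_products_le (B x z - (LinearMap.range ι).starProjection (B x z))
      (s := Finset.univ)
    refine le_trans (le_of_eq ?_) this
    rw [Finset.mul_sum]
    refine Finset.sum_congr rfl fun l _ => ?_
    rw [real_inner_smul_left, Real.norm_eq_abs, sq_abs, mul_pow, inner_sub_right,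
      real_inner_comm ((LinearMap.range ι).starProjection (B x z)) (F (b l)),
      hFn _ (b l).2 _ (Submodule.starProjection_apply_mem _ _), sub_zero, real_inner_comm]
  have hval : ∀ x ∈ T, ∀ y ∈ T, J (ι x) = ι y → ∀ k l, (inner ℝ (B x (b k)) (F (b l)) : ℝ) =
      -(inner ℝ y t) * inner ℝ (b k : V) (b l) - inner ℝ x t * inner ℝ (ι (b k)) (Q (ι (b l))) := by
    intro x hx y hy hxy k l
    obtain ⟨w', hw', hw''⟩ := hQmem (ι (b l))
    rw [hFapp, inner_sub_right, hmixJ x hx y hy hxy _ (b k).2 _ (b l).2, ← hw'',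
      hmix x hx _ (b k).2 w' hw', hι]
  have hsum : ∀ x ∈ T, ∀ y ∈ T, J (ι x) = ι y →
      ∑ k, ∑ l, (inner ℝ (B x (b k)) (F (b l)) : ℝ) ^ 2 =
        Fintype.card β * (inner ℝ y t) ^ 2 + Fintype.card β * c ^ 2 * (inner ℝ x t) ^ 2 := by
    classical
    intro x hx y hy hxy
    have h1 : ∀ k l, (inner ℝ (B x (b k)) (F (b l)) : ℝ) ^ 2 =
        (if k = l then (inner ℝ y t) ^ 2 else 0)
          + (inner ℝ x t) ^ 2 * (inner ℝ (ι (b k)) (Q (ι (b l)))) ^ 2 := by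
      intro k l
      rw [hval x hx y hy hxy, ← Submodule.coe_inner, orthonormal_iff_ite.1 b.orthonormal k l]
      split_ifs with hkl
      · subst hkl
        have h2 : inner ℝ (ι (b k)) (Q (ι (b k))) = (0 : ℝ) := by
          have h3 := hQorth (ι (b k)) _ (b k).2
          rw [inner_sub_left] at h3
          have h4 := hskew (ι (b k)) (ι (b k))
          rw [real_inner_comm] at h4
          rw [real_inner_comm]
          rw [real_inner_comm] at h3
          linarith
        rw [h2]; ring
      · ring
    have h5 : ∀ l, ∑ k, (inner ℝ (ι (b k)) (Q (ι (b l))) : ℝ) ^ 2 = c ^ 2 := by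
      intro l
      obtain ⟨w', hw', hw''⟩ := hQmem (ι (b l))
      rw [← hw'']
      simp_rw [hι]
      rw [b.sum_inner_sq_of_mem hw']
      have h6 : ‖Q (ι (b l))‖ ^ 2 = c ^ 2 * ‖(b l : V)‖ ^ 2 := hslant _ (b l).2
      have h7 : ‖(b l : V)‖ = 1 := b.orthonormal.1 l
      rw [← hw'', ← real_inner_self_eq_norm_sq, hι, real_inner_self_eq_norm_sq, h7] at h6
      linarith
    simp_rw [h1, Finset.sum_add_distrib]
    congr 1
    · simp
    · rw [Finset.sum_comm]
      simp_rw [← Finset.mul_sum, h5]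
      simp; ring
  obtain ⟨t', ht', htt'⟩ := hJT t ht
  have htn : ‖t'‖ ^ 2 = ‖t‖ ^ 2 := by
    rw [← real_inner_self_eq_norm_sq, ← real_inner_self_eq_norm_sq, ← hι, ← htt', hJ, hι]
  have hrow : ∀ i, (s⁻¹) ^ 2 * (Fintype.card β * (inner ℝ (a i : V) t') ^ 2
      + Fintype.card β * c ^ 2 * (inner ℝ (a i : V) t) ^ 2) ≤
      ∑ k, ‖B (a i) (b k) - (LinearMap.range ι).starProjection (B (a i) (b k))‖ ^ 2 := by
    intro i
    obtain ⟨y, hy, hxy⟩ := hJT _ (a i).2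
    have h1 : (inner ℝ y t : ℝ) = -inner ℝ (a i : V) t' := by
      rw [← hι, ← hxy, hskew, htt', hι]
    have h2 := hsum _ (a i).2 y hy hxy
    rw [h1, neg_sq] at h2
    rw [← h2, Finset.mul_sum]
    exact Finset.sum_le_sum fun k _ => hbessel _ (a i).2 _ (b k).2
  refine le_trans (le_of_eq ?_) (Finset.sum_le_sum fun i _ => hrow i)
  rw [← Finset.mul_sum, Finset.sum_add_distrib, ← Finset.mul_sum, ← Finset.mul_sum,
    a.sum_inner_sq_of_mem ht', a.sum_inner_sq_of_mem ht, htn]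
  field_simp

/-- Splitting `‖H‖²` along an orthogonal decomposition `V = T ⊕ S`: the mixed terms occur twice. -/
lemma sum_sum_norm_sq_eq_of_sup {T S : Submodule ℝ V}
    (hTS : ∀ x ∈ T, ∀ z ∈ S, inner ℝ x z = (0 : ℝ)) (hsup : T ⊔ S = ⊤)
    {α β γ : Type*} [Fintype α] [Fintype β] [Fintype γ]
    (a : OrthonormalBasis α ℝ T) (b : OrthonormalBasis β ℝ S) (e : OrthonormalBasis γ ℝ V)
    (H : V →ₗ[ℝ] V →ₗ[ℝ] U) (hH : ∀ v w, H v w = H w v) :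
    ∑ i, ∑ j, ‖H (e i) (e j)‖ ^ 2 = ∑ i, ∑ j, ‖H (a i) (a j)‖ ^ 2
      + 2 * ∑ i, ∑ j, ‖H (a i) (b j)‖ ^ 2 + ∑ i, ∑ j, ‖H (b i) (b j)‖ ^ 2 := by
  obtain ⟨c, hc1, hc2⟩ := exists_orthonormalBasis_sum hTS hsup a b
  rw [sum_sum_norm_sq_orthonormalBasis e c]
  simp only [Fintype.sum_sum_type, hc1, hc2, Finset.sum_add_distrib]
  have : ∑ i, ∑ j, ‖H (b i) (a j)‖ ^ 2 = ∑ i, ∑ j, ‖H (a i) (b j)‖ ^ 2 := by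
    rw [Finset.sum_comm]
    exact Finset.sum_congr rfl fun i _ => Finset.sum_congr rfl fun j _ => by rw [hH]
  rw [this]; ring

omit [FiniteDimensional ℝ V] in
lemma bilinear_eq_zero_of_sum_norm_sq {T S : Submodule ℝ V} {α β : Type*} [Fintype α] [Fintype β]
    (a : OrthonormalBasis α ℝ T) (b : OrthonormalBasis β ℝ S) (H : V →ₗ[ℝ] V →ₗ[ℝ] U)
    (h : ∑ i, ∑ j, ‖H (a i) (b j)‖ ^ 2 = 0) : ∀ x ∈ T, ∀ z ∈ S, H x z = 0 := by
  have h0 : ∀ i j, H (a i) (b j) = 0 := by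
    intro i j
    have h1 := (Finset.sum_eq_zero_iff_of_nonneg
      (fun i _ => Finset.sum_nonneg fun j _ => sq_nonneg ‖H (a i) (b j)‖)).1 h i (Finset.mem_univ i)
    have h2 := (Finset.sum_eq_zero_iff_of_nonneg
      (fun j _ => sq_nonneg ‖H (a i) (b j)‖)).1 h1 j (Finset.mem_univ j)
    simpa using h2
  intro x hx z hz
  have hx' : x = ∑ i, inner ℝ (a i) (⟨x, hx⟩ : T) • (a i : V) := by
    simpa using congrArg Subtype.val (a.sum_repr' ⟨x, hx⟩).symm
  have hz' : z = ∑ i, inner ℝ (b i) (⟨z, hz⟩ : S) • (b i : V) := by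
    simpa using congrArg Subtype.val (b.sum_repr' ⟨z, hz⟩).symm
  rw [hx', hz']
  simp [h0]

end LinearAlgebra

section LinearAlgebraEstimate

variable {V U : Type*} [NormedAddCommGroup V] [InnerProductSpace ℝ V] [FiniteDimensional ℝ V]
  [NormedAddCommGroup U] [InnerProductSpace ℝ U]

/-- A bilinear map that vanishes on `T × T` and on `S × S` has vanishing trace. -/
lemma sum_diag_eq_zero_of_sup {T S : Submodule ℝ V}
    (hTS : ∀ x ∈ T, ∀ z ∈ S, inner ℝ x z = (0 : ℝ)) (hsup : T ⊔ S = ⊤)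
    {γ : Type*} [Fintype γ] (e : OrthonormalBasis γ ℝ V) (H : V →ₗ[ℝ] V →ₗ[ℝ] U)
    (hT : ∀ x ∈ T, ∀ y ∈ T, H x y = 0) (hS : ∀ z ∈ S, ∀ w ∈ S, H z w = 0) :
    ∑ i, H (e i) (e i) = 0 := by
  obtain ⟨c, hc1, hc2⟩ := exists_orthonormalBasis_sum hTS hsup
    (stdOrthonormalBasis ℝ T) (stdOrthonormalBasis ℝ S)
  rw [sum_diag_orthonormalBasis e c, Fintype.sum_sum_type]
  simp only [hc1, hc2]
  simp [hT, hS]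

/-- The estimate of `‖H‖²` from its mixed part; equality forces the other parts to vanish. -/
lemma two_mul_le_sum_sum_norm_sq {T S : Submodule ℝ V}
    (hTS : ∀ x ∈ T, ∀ z ∈ S, inner ℝ x z = (0 : ℝ)) (hsup : T ⊔ S = ⊤)
    {γ : Type*} [Fintype γ] (e : OrthonormalBasis γ ℝ V) (H : V →ₗ[ℝ] V →ₗ[ℝ] U)
    (hH : ∀ v w, H v w = H w v) {m : ℝ}
    (hm : m ≤ ∑ i, ∑ j, ‖H (stdOrthonormalBasis ℝ T i) (stdOrthonormalBasis ℝ S j)‖ ^ 2) :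
    2 * m ≤ ∑ i, ∑ j, ‖H (e i) (e j)‖ ^ 2 ∧
      (∑ i, ∑ j, ‖H (e i) (e j)‖ ^ 2 = 2 * m →
        (∀ x ∈ T, ∀ y ∈ T, H x y = 0) ∧ ∀ z ∈ S, ∀ w ∈ S, H z w = 0) := by
  have h1 := sum_sum_norm_sq_eq_of_sup hTS hsup (stdOrthonormalBasis ℝ T)
    (stdOrthonormalBasis ℝ S) e H hH
  have h2 : 0 ≤ ∑ i, ∑ j, ‖H (stdOrthonormalBasis ℝ T i) (stdOrthonormalBasis ℝ T j)‖ ^ 2 := by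
    positivity
  have h3 : 0 ≤ ∑ i, ∑ j, ‖H (stdOrthonormalBasis ℝ S i) (stdOrthonormalBasis ℝ S j)‖ ^ 2 := by
    positivity
  refine ⟨by linarith, fun h => ⟨?_, ?_⟩⟩
  · exact bilinear_eq_zero_of_sum_norm_sq _ _ H (by linarith)
  · exact bilinear_eq_zero_of_sum_norm_sq _ _ H (by linarith)

omit [FiniteDimensional ℝ V] in
/-- The angle between a vector and its projection, also when the projection vanishes. -/
lemma norm_sq_starProjection_of_angle_eq (P : Submodule ℝ V) [P.HasOrthogonalProjection] {a : V}
    {θ : ℝ} (h : InnerProductGeometry.angle a (P.starProjection a) = θ) :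
    ‖P.starProjection a‖ ^ 2 = Real.cos θ ^ 2 * ‖a‖ ^ 2 := by
  have h1 := InnerProductGeometry.cos_angle_mul_norm_mul_norm a (P.starProjection a)
  have h2 : inner ℝ a (P.starProjection a) = ‖P.starProjection a‖ ^ 2 := by
    have h3 := P.starProjection_inner_eq_zero a _ (P.starProjection_apply_mem a)
    rw [inner_sub_left, real_inner_self_eq_norm_sq] at h3
    linarith
  rw [h, h2] at h1
  by_cases h0 : P.starProjection a = 0
  · rw [h0, InnerProductGeometry.angle_zero_right] at h
    rw [← h, h0]
    simp
  · have h4 : ‖P.starProjection a‖ ≠ 0 := norm_ne_zero_iff.2 h0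
    have h5 : ‖P.starProjection a‖ = Real.cos θ * ‖a‖ := by
      apply mul_right_cancel₀ h4
      linarith
    rw [h5]; ring

end LinearAlgebraEstimate

/-! ### The connection along a map -/

section AlongMap

open Filter Topology

variable {E : Type*} [NormedAddCommGroup E] [NormedSpace ℝ E] [FiniteDimensional ℝ E]
  {H : Type*} [TopologicalSpace H] {I : ModelWithCorners ℝ E H}
  {N : Type*} [TopologicalSpace N] [ChartedSpace H N] [IsManifold I ∞ N]
  {F : Type*} [NormedAddCommGroup F] [NormedSpace ℝ F]
  {G : Type*} [TopologicalSpace G] {K : ModelWithCorners ℝ F G}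
  {M : Type*} [TopologicalSpace M] [ChartedSpace G M]

omit [FiniteDimensional ℝ E] in
/-- The extension of tangent vectors by constants in a trivialization is linear. -/
lemma extend_sum {κ : Type*} (s : Finset κ) {y z : N}
    (hz : z ∈ (trivializationAt E (TangentSpace I : N → Type _) y).baseSet)
    (c : κ → ℝ) (a : κ → TangentSpace I y) :
    FiberBundle.extend E (∑ i ∈ s, c i • a i) z = ∑ i ∈ s, c i • FiberBundle.extend E (a i) z := by
  have h : ∀ w : TangentSpace I y, FiberBundle.extend E w z =
      (trivializationAt E (TangentSpace I : N → Type _) y).symmL ℝ z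
        ((trivializationAt E (TangentSpace I : N → Type _) y).continuousLinearMapAt ℝ y w) := by
    intro w
    rw [Trivialization.symmL_apply _ hz, Trivialization.continuousLinearMapAt_apply,
      Trivialization.linearMapAt_apply, if_pos (FiberBundle.mem_baseSet_trivializationAt' y)]
    rfl
  simp only [h, map_sum, map_smul]

/-- The `i`-th component functional of a basis `b` of `T_y N`, read in the trivialization at `y`. -/
def coordFunctional {κ : Type*} {y : N} (b : Module.Basis κ ℝ (TangentSpace I y)) (i : κ) :
    E →L[ℝ] ℝ :=
  LinearMap.toContinuousLinearMap
    (b.coord i ∘ₗ (trivializationAt E (TangentSpace I : N → Type _) y).symmₗ ℝ y)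

lemma sum_coordFunctional_smul {κ : Type*} [Fintype κ] {y : N}
    (b : Module.Basis κ ℝ (TangentSpace I y)) (a : E) :
    ∑ i, coordFunctional b i a • b i
      = (trivializationAt E (TangentSpace I : N → Type _) y).symm y a := by
  rw [← Trivialization.symmₗ_apply (R := ℝ) _ (FiberBundle.mem_baseSet_trivializationAt' y)]
  exact b.sum_repr _

/-- Near `y`, a vector is the sum of its components along the frame extending a basis of `T_y N`. -/
lemma eq_sum_coordFunctional_smul_extend {κ : Type*} [Fintype κ] {y : N}
    (b : Module.Basis κ ℝ (TangentSpace I y)) {z : N}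
    (hz : z ∈ (trivializationAt E (TangentSpace I : N → Type _) y).baseSet)
    (u : TangentSpace I z) :
    u = ∑ i, coordFunctional b i
      ((trivializationAt E (TangentSpace I : N → Type _) y) (⟨z, u⟩ : TangentBundle I N)).2 •
        FiberBundle.extend E (b i) z := by
  rw [← extend_sum Finset.univ hz, sum_coordFunctional_smul]
  simp only [FiberBundle.extend]
  rw [Trivialization.apply_mk_symm _
    (FiberBundle.mem_baseSet_trivializationAt' (F := E) (E := (TangentSpace I : N → Type _)) y)]
  exact (Trivialization.symm_apply_apply_mk _ hz u).symm

lemma MDifferentiableAt.coordFunctional_comp {κ : Type*} {y : N}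
    (b : Module.Basis κ ℝ (TangentSpace I y)) (i : κ) {g : M → E} {p : M}
    (hg : MDifferentiableAt K 𝓘(ℝ, E) g p) :
    MDifferentiableAt K 𝓘(ℝ) (fun q => coordFunctional b i (g q)) p :=
  (coordFunctional b i).mdifferentiableAt.comp p hg

lemma mvfderiv_coordFunctional_comp {κ : Type*} {y : N}
    (b : Module.Basis κ ℝ (TangentSpace I y)) (i : κ) {g : M → E} {p : M}
    (hg : MDifferentiableAt K 𝓘(ℝ, E) g p) (v : TangentSpace K p) :
    mvfderiv K (fun q => coordFunctional b i (g q)) p v = coordFunctional b i (mvfderiv K g p v) := by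
  have := mfderiv_comp_apply p (coordFunctional b i).mdifferentiableAt hg v
  rw [ContinuousLinearMap.mfderiv_eq] at this
  exact this

variable (cov : CovariantDerivative I E (TangentSpace I : N → Type _))

omit [FiniteDimensional ℝ E] in
lemma cov_sum_smul {κ : Type*} (s : Finset κ) {y : N} {c : κ → N → ℝ}
    {Y : κ → ∀ z : N, TangentSpace I z}
    (hc : ∀ i, MDifferentiableAt I 𝓘(ℝ) (c i) y)
    (hY : ∀ i, MDifferentiableAt I (I.prod 𝓘(ℝ, E))
      (fun z => (⟨z, Y i z⟩ : TangentBundle I N)) y) (u : TangentSpace I y) :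
    cov (fun z => ∑ i ∈ s, c i z • Y i z) y u
      = ∑ i ∈ s, (mvfderiv I (c i) y u • Y i y + c i y • cov (Y i) y u) := by
  classical
  induction s using Finset.induction_on with
  | empty =>
    simp only [Finset.sum_empty]
    have h := cov.isCovariantDerivativeOnUniv.zero (x := y) (F := E)
    exact congrArg (fun L : TangentSpace I y →L[ℝ] TangentSpace I y => L u) h
  | insert i s hi ih =>
    have h1 : (fun z => ∑ j ∈ insert i s, c j z • Y j z)
        = (c i • Y i) + fun z => ∑ j ∈ s, c j z • Y j z := by
      funext z; simp [Finset.sum_insert hi]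
    have h2 : MDifferentiableAt I (I.prod 𝓘(ℝ, E))
        (fun z => (⟨z, ∑ j ∈ s, c j z • Y j z⟩ : TangentBundle I N)) y :=
      MDifferentiableAt.sum_section fun j _ => (hc j).smul_section (hY j)
    rw [h1, cov.isCovariantDerivativeOnUniv.add ((hc i).smul_section (hY i)) h2,
      _root_.add_apply, ih, Finset.sum_insert hi,
      cov.isCovariantDerivativeOnUniv.leibniz (hY i) (hc i)]
    simp [add_comm]

omit [FiniteDimensional ℝ E] in
/-- At the base point, `a ↦ ∇ (extend a)` is linear. -/
lemma cov_extend_sum {κ : Type*} (s : Finset κ) {y : N} (c : κ → ℝ) (a : κ → TangentSpace I y)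
    (u : TangentSpace I y) :
    cov (FiberBundle.extend E (∑ i ∈ s, c i • a i)) y u
      = ∑ i ∈ s, c i • cov (FiberBundle.extend E (a i)) y u := by
  have hc : ∀ i, MDifferentiableAt I 𝓘(ℝ) (fun _ : N => c i) y := fun i => mdifferentiableAt_const
  have he : ∀ i, MDifferentiableAt I (I.prod 𝓘(ℝ, E))
      (fun z => (⟨z, FiberBundle.extend E (a i) z⟩ : TangentBundle I N)) y :=
    fun i => FiberBundle.mdifferentiableAt_extend I E (a i)
  have h4 : ∀ᶠ z in 𝓝 y, FiberBundle.extend E (∑ i ∈ s, c i • a i) z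
      = ∑ i ∈ s, c i • FiberBundle.extend E (a i) z := by
    filter_upwards [(trivializationAt E (TangentSpace I : N → Type _) y).open_baseSet.mem_nhds
      (FiberBundle.mem_baseSet_trivializationAt' y)] with z hz
    rw [← extend_sum s hz]
  have h6 := cov.isCovariantDerivativeOnUniv.congr_of_eventuallyEq
    (FiberBundle.mdifferentiableAt_extend I E (∑ i ∈ s, c i • a i))
    (MDifferentiableAt.sum_section (s := s) fun i _ => (hc i).smul_section (he i))
    univ_mem h4
  rw [h6]
  refine (cov_sum_smul cov s hc he u).trans (Finset.sum_congr rfl fun i _ => ?_)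
  rw [mvfderiv_const]
  simp

omit [FiniteDimensional ℝ E] in
/-- Components of a differentiable section along a map. -/
lemma mdifferentiableAt_trivialization_snd {φ : M → N} {W : ∀ p : M, TangentSpace I (φ p)} {p : M}
    (hW : MDifferentiableAt K (I.prod 𝓘(ℝ, E)) (fun q => (⟨φ q, W q⟩ : TangentBundle I N)) p) :
    MDifferentiableAt K 𝓘(ℝ, E) (fun q => ((trivializationAt E (TangentSpace I : N → Type _) (φ p))
        (⟨φ q, W q⟩ : TangentBundle I N)).2) p :=
  ((mdifferentiableAt_totalSpace _ _).1 hW).2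

omit [FiniteDimensional ℝ E] in
lemma mdifferentiableAt_of_totalSpace {φ : M → N} {W : ∀ p : M, TangentSpace I (φ p)} {p : M}
    (hW : MDifferentiableAt K (I.prod 𝓘(ℝ, E)) (fun q => (⟨φ q, W q⟩ : TangentBundle I N)) p) :
    MDifferentiableAt K I φ p :=
  ((mdifferentiableAt_totalSpace _ _).1 hW).1

lemma eventually_eq_sum_extend {κ : Type*} [Fintype κ] {φ : M → N} {p : M}
    (hφ : ContinuousAt φ p) (b : Module.Basis κ ℝ (TangentSpace I (φ p)))
    (W : ∀ p : M, TangentSpace I (φ p)) :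
    ∀ᶠ q in 𝓝 p, W q = ∑ i, coordFunctional b i
      ((trivializationAt E (TangentSpace I : N → Type _) (φ p))
        (⟨φ q, W q⟩ : TangentBundle I N)).2 • FiberBundle.extend E (b i) (φ q) := by
  have h := hφ.eventually ((trivializationAt E (TangentSpace I : N → Type _)
    (φ p)).open_baseSet.mem_nhds (FiberBundle.mem_baseSet_trivializationAt' (φ p)))
  exact h.mono fun q hq => eq_sum_coordFunctional_smul_extend b hq (W q)

/-- The connection in the frame extending a basis of the tangent space. -/
lemma cov_eq_symm_mvfderiv_add {Y : ∀ z : N, TangentSpace I z} {y : N}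
    (hY : MDifferentiableAt I (I.prod 𝓘(ℝ, E)) (fun z => (⟨z, Y z⟩ : TangentBundle I N)) y)
    (u : TangentSpace I y) :
    cov Y y u = (trivializationAt E (TangentSpace I : N → Type _) y).symm y
      (mvfderiv I (fun z => ((trivializationAt E (TangentSpace I : N → Type _) y)
        (⟨z, Y z⟩ : TangentBundle I N)).2) y u) + cov (FiberBundle.extend E (Y y)) y u := by
  set b := Module.finBasis ℝ (TangentSpace I y)
  have hg := mdifferentiableAt_trivialization_snd (φ := id) hY
  have hc := fun i => MDifferentiableAt.coordFunctional_comp b i hg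
  have he : ∀ i, MDifferentiableAt I (I.prod 𝓘(ℝ, E))
      (fun z => (⟨z, FiberBundle.extend E (b i) z⟩ : TangentBundle I N)) y :=
    fun i => FiberBundle.mdifferentiableAt_extend I E (b i)
  have h1 := eventually_eq_sum_extend (φ := id) continuousAt_id b Y
  have hS : MDifferentiableAt I (I.prod 𝓘(ℝ, E)) (fun z => (⟨z, ∑ i, coordFunctional b i
      ((trivializationAt E (TangentSpace I : N → Type _) y)
        (⟨z, Y z⟩ : TangentBundle I N)).2 • FiberBundle.extend E (b i) z⟩ : TangentBundle I N)) y :=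
    by
    have := MDifferentiableAt.sum_section (I := I) (F := E) (E := (TangentSpace I : N → Type _))
      (s := Finset.univ) fun i _ => (hc i).smul_section (he i)
    exact this
  have h2 := cov.isCovariantDerivativeOnUniv.congr_of_eventuallyEq hY hS univ_mem h1
  have h3 := cov_sum_smul cov Finset.univ hc he u
  have hw : Y y = ∑ i, coordFunctional b i ((trivializationAt E (TangentSpace I : N → Type _) y)
        (⟨y, Y y⟩ : TangentBundle I N)).2 • b i := by
    conv_lhs => rw [h1.self_of_nhds]
    simp only [id, FiberBundle.extend_apply_self]
  have h5 : cov (FiberBundle.extend E (Y y)) y u = _ :=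
    (congrArg (fun w => cov (FiberBundle.extend E w) y u) hw).trans (cov_extend_sum cov _ _ _ u)
  rw [h2, h5]
  refine h3.trans ?_
  refine Eq.trans ?_ (congrArg (· + _) (sum_coordFunctional_smul b _))
  rw [← Finset.sum_add_distrib]
  refine Finset.sum_congr rfl fun i _ => ?_
  rw [mvfderiv_coordFunctional_comp b i hg u]
  simp

omit [FiniteDimensional ℝ E] in
lemma covAlong_congr {φ : M → N} {W W' : ∀ p : M, TangentSpace I (φ p)} {p : M}
    (h : ∀ᶠ q in 𝓝 p, W q = W' q) (v : TangentSpace K p) :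
    covAlong K cov φ W p v = covAlong K cov φ W' p v := by
  have h1 : (fun q => ((trivializationAt E (TangentSpace I : N → Type _) (φ p))
      (⟨φ q, W q⟩ : TangentBundle I N)).2) =ᶠ[𝓝 p]
      fun q => ((trivializationAt E (TangentSpace I : N → Type _) (φ p))
      (⟨φ q, W' q⟩ : TangentBundle I N)).2 := h.mono fun q hq => by simp only [hq]
  simp only [covAlong, mvfderiv]
  rw [h1.mfderiv_eq, h.self_of_nhds]
  rfl

omit [FiniteDimensional ℝ E] in
lemma mvfderiv_finset_sum_smul {κ : Type*} (s : Finset κ) {p : M} {c : κ → M → ℝ} {g : κ → M → E}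
    (hc : ∀ i, MDifferentiableAt K 𝓘(ℝ) (c i) p) (hg : ∀ i, MDifferentiableAt K 𝓘(ℝ, E) (g i) p)
    (v : TangentSpace K p) :
    mvfderiv K (fun q => ∑ i ∈ s, c i q • g i q) p v
      = ∑ i ∈ s, (mvfderiv K (c i) p v • g i p + c i p • mvfderiv K (g i) p v) := by
  classical
  have hd : ∀ t : Finset κ, MDifferentiableAt K 𝓘(ℝ, E) (fun q => ∑ i ∈ t, c i q • g i q) p := by
    intro t
    induction t using Finset.induction_on with
    | empty => simpa using mdifferentiableAt_const
    | insert i t hi ih =>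
      simp only [Finset.sum_insert hi]
      exact ((hc i).smul (hg i)).add ih
  induction s using Finset.induction_on with
  | empty => simp [mvfderiv_const]
  | insert i s hi ih =>
    simp only [Finset.sum_insert hi]
    have h1 : mvfderiv K (fun q => c i q • g i q + ∑ j ∈ s, c j q • g j q) p
        = mvfderiv K (fun q => c i q • g i q) p + mvfderiv K (fun q => ∑ j ∈ s, c j q • g j q) p :=
      mvfderiv_fun_add ((hc i).smul (hg i)) (hd s)
    rw [h1, _root_.add_apply, ih, mvfderiv_fun_smul (hc i) (hg i)]
    simp [add_comm]

lemma mvfderiv_sum_sum_mul {κ : Type*} [Fintype κ] {p : M} {w x : κ → M → ℝ} {g : κ → κ → M → ℝ}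
    (hw : ∀ i, MDifferentiableAt K 𝓘(ℝ) (w i) p) (hx : ∀ i, MDifferentiableAt K 𝓘(ℝ) (x i) p)
    (hg : ∀ i j, MDifferentiableAt K 𝓘(ℝ) (g i j) p) (v : TangentSpace K p) :
    mvfderiv K (fun q => ∑ i, ∑ j, w i q * x j q * g i j q) p v
      = ∑ i, ∑ j, ((w i p * mvfderiv K (x j) p v + x j p * mvfderiv K (w i) p v) * g i j p
        + w i p * x j p * mvfderiv K (g i j) p v) := by
  have h := mvfderiv_finset_sum_smul (E := ℝ) Finset.univ
    (c := fun (k : κ × κ) q => w k.1 q * x k.2 q) (g := fun k => g k.1 k.2)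
    (fun k => (hw k.1).mul (hx k.2)) (fun k => hg k.1 k.2) v
  simp only [Fintype.sum_prod_type, smul_eq_mul] at h
  rw [h]
  refine Finset.sum_congr rfl fun i _ => Finset.sum_congr rfl fun j _ => ?_
  rw [mvfderiv_fun_mul (hw i) (hx j)]
  rfl

/-- The connection along `φ` of a combination of pulled back vector fields of `N`: Leibniz rule and
`∇_v (Y ∘ φ) = ∇_{dφ v} Y`. -/
lemma covAlong_sum_smul {κ : Type*} [Fintype κ] {φ : M → N} {p : M}
    (hφ : MDifferentiableAt K I φ p) {c : κ → M → ℝ} {Y : κ → ∀ z : N, TangentSpace I z}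
    (hc : ∀ i, MDifferentiableAt K 𝓘(ℝ) (c i) p)
    (hY : ∀ i, MDifferentiableAt I (I.prod 𝓘(ℝ, E))
      (fun z => (⟨z, Y i z⟩ : TangentBundle I N)) (φ p)) (v : TangentSpace K p) :
    covAlong K cov φ (fun q => ∑ i, c i q • Y i (φ q)) p v
      = ∑ i, (mvfderiv K (c i) p v • Y i (φ p) + c i p • cov (Y i) (φ p) (mfderiv K I φ p v)) := by
  set e := trivializationAt E (TangentSpace I : N → Type _) (φ p) with he
  have hbase : φ p ∈ e.baseSet := FiberBundle.mem_baseSet_trivializationAt' (φ p)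
  have hmem : ∀ᶠ q in 𝓝 p, φ q ∈ e.baseSet :=
    hφ.continuousAt.eventually (e.open_baseSet.mem_nhds hbase)
  have hYe : ∀ i, MDifferentiableAt I 𝓘(ℝ, E)
      (fun z => (e (⟨z, Y i z⟩ : TangentBundle I N)).2) (φ p) :=
    fun i => mdifferentiableAt_trivialization_snd (φ := id) (hY i)
  have hYφ : ∀ i, MDifferentiableAt K 𝓘(ℝ, E)
      (fun q => (e (⟨φ q, Y i (φ q)⟩ : TangentBundle I N)).2) p :=
    fun i => (hYe i).comp p hφ
  have h1 : (fun q => (e (⟨φ q, ∑ i, c i q • Y i (φ q)⟩ : TangentBundle I N)).2) =ᶠ[𝓝 p]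
      fun q => ∑ i, c i q • (e (⟨φ q, Y i (φ q)⟩ : TangentBundle I N)).2 := by
    filter_upwards [hmem] with q hq
    have h := fun w : TangentSpace I (φ q) => congrFun (e.coe_linearMapAt_of_mem (R := ℝ) hq) w
    simp only [← h, map_sum, map_smul]
  have h2 : mvfderiv K (fun q => (e (⟨φ q, ∑ i, c i q • Y i (φ q)⟩ : TangentBundle I N)).2) p v
      = ∑ i, (mvfderiv K (c i) p v • (e (⟨φ p, Y i (φ p)⟩ : TangentBundle I N)).2 +
        c i p • mvfderiv I (fun z => (e (⟨z, Y i z⟩ : TangentBundle I N)).2) (φ p)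
          (mfderiv K I φ p v)) := by
    have h3 := mvfderiv_finset_sum_smul Finset.univ hc hYφ v
    have h4 : mvfderiv K (fun q => (e (⟨φ q, ∑ i, c i q • Y i (φ q)⟩ : TangentBundle I N)).2) p v
        = mvfderiv K (fun q => ∑ i, c i q • (e (⟨φ q, Y i (φ q)⟩ : TangentBundle I N)).2) p v := by
      simp only [mvfderiv]
      rw [h1.mfderiv_eq]
      rfl
    rw [h4, h3]
    refine Finset.sum_congr rfl fun i _ => ?_
    congr 2
    exact mfderiv_comp_apply p (hYe i) hφ v
  have h5 : covAlong K cov φ (fun q => ∑ i, c i q • Y i (φ q)) p v = e.symmₗ ℝ (φ p)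
      (mvfderiv K (fun q => (e (⟨φ q, ∑ i, c i q • Y i (φ q)⟩ : TangentBundle I N)).2) p v)
      + cov (FiberBundle.extend E (∑ i, c i p • Y i (φ p))) (φ p) (mfderiv K I φ p v) := by
    rw [Trivialization.symmₗ_apply _ hbase]; rfl
  rw [h5, h2, cov_extend_sum, map_sum, ← Finset.sum_add_distrib]
  refine Finset.sum_congr rfl fun i _ => ?_
  rw [cov_eq_symm_mvfderiv_add cov (hY i), map_add, map_smul, map_smul,
    ← Trivialization.symmₗ_apply (R := ℝ) _ hbase, smul_add, ← add_assoc]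
  congr 3
  rw [Trivialization.symmₗ_apply _ hbase]
  exact Trivialization.symm_apply_apply_mk _ hbase _

/-- The connection along `φ`, of a differentiable section, in the frame that extends a basis. -/
lemma covAlong_eq_sum {κ : Type*} [Fintype κ] {φ : M → N} {W : ∀ p : M, TangentSpace I (φ p)} {p : M}
    (b : Module.Basis κ ℝ (TangentSpace I (φ p)))
    (hW : MDifferentiableAt K (I.prod 𝓘(ℝ, E)) (fun q => (⟨φ q, W q⟩ : TangentBundle I N)) p)
    (v : TangentSpace K p) :
    covAlong K cov φ W p v = ∑ i, (mvfderiv K (fun q => coordFunctional b i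
        ((trivializationAt E (TangentSpace I : N → Type _) (φ p))
          (⟨φ q, W q⟩ : TangentBundle I N)).2) p v • b i
      + coordFunctional b i ((trivializationAt E (TangentSpace I : N → Type _) (φ p))
          (⟨φ p, W p⟩ : TangentBundle I N)).2 •
        cov (FiberBundle.extend E (b i)) (φ p) (mfderiv K I φ p v)) := by
  have hφ := mdifferentiableAt_of_totalSpace hW
  rw [covAlong_congr cov (eventually_eq_sum_extend hφ.continuousAt b W),
    covAlong_sum_smul cov hφ (fun i => MDifferentiableAt.coordFunctional_comp b i
      (mdifferentiableAt_trivialization_snd hW))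
      (fun i => FiberBundle.mdifferentiableAt_extend I E (b i))]
  simp only [FiberBundle.extend_apply_self]

lemma mdifferentiableAt_coord_section {κ : Type*} {φ : M → N}
    {W : ∀ p : M, TangentSpace I (φ p)} {p : M}
    (b : Module.Basis κ ℝ (TangentSpace I (φ p)))
    (hW : MDifferentiableAt K (I.prod 𝓘(ℝ, E)) (fun q => (⟨φ q, W q⟩ : TangentBundle I N)) p)
    (i : κ) : MDifferentiableAt K 𝓘(ℝ) (fun q => coordFunctional b i
        ((trivializationAt E (TangentSpace I : N → Type _) (φ p))
          (⟨φ q, W q⟩ : TangentBundle I N)).2) p :=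
  MDifferentiableAt.coordFunctional_comp b i (mdifferentiableAt_trivialization_snd hW)

omit [FiniteDimensional ℝ E] in
/-- The chain rule for the connection along a map. -/
lemma covAlong_comp {F' G' M' : Type*} [NormedAddCommGroup F'] [NormedSpace ℝ F']
    [TopologicalSpace G'] {K' : ModelWithCorners ℝ F' G'}
    [TopologicalSpace M'] [ChartedSpace G' M'] {φ : M → N} {κ : M' → M}
    {W : ∀ p : M, TangentSpace I (φ p)} {p : M'}
    (hκ : MDifferentiableAt K' K κ p)
    (hW : MDifferentiableAt K (I.prod 𝓘(ℝ, E)) (fun q => (⟨φ q, W q⟩ : TangentBundle I N)) (κ p))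
    (v : TangentSpace K' p) :
    covAlong K' cov (fun q => φ (κ q)) (fun q => W (κ q)) p v
      = covAlong K cov φ W (κ p) (mfderiv K' K κ p v) := by
  have h1 := mfderiv_comp_apply p (mdifferentiableAt_trivialization_snd hW) hκ v
  have h2 := mfderiv_comp_apply p (mdifferentiableAt_of_totalSpace hW) hκ v
  unfold covAlong
  congr 1
  · exact congrArg _ h1
  · exact congrArg _ h2

variable [RiemannianBundle (fun x : N => TangentSpace I x)]
  [IsContMDiffRiemannianBundle I ∞ E (fun x : N => TangentSpace I x)]

variable {cov}

/-- The connection along a map, induced by the Levi-Civita connection, is compatible with the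
metric. -/
lemma IsLeviCivita.mvfderiv_inner_covAlong (hcov : IsLeviCivita cov) {φ : M → N}
    {W V : ∀ p : M, TangentSpace I (φ p)} {p : M}
    (hW : MDifferentiableAt K (I.prod 𝓘(ℝ, E)) (fun q => (⟨φ q, W q⟩ : TangentBundle I N)) p)
    (hV : MDifferentiableAt K (I.prod 𝓘(ℝ, E)) (fun q => (⟨φ q, V q⟩ : TangentBundle I N)) p)
    (v : TangentSpace K p) :
    mvfderiv K (fun q => (inner ℝ (W q) (V q) : ℝ)) p v
      = inner ℝ (covAlong K cov φ W p v) (V p) + inner ℝ (W p) (covAlong K cov φ V p v) := by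
  set b := Module.finBasis ℝ (TangentSpace I (φ p))
  have hφ := mdifferentiableAt_of_totalSpace hW
  have hw := mdifferentiableAt_coord_section b hW
  have hv := mdifferentiableAt_coord_section b hV
  have eW := eventually_eq_sum_extend hφ.continuousAt b W
  have eV := eventually_eq_sum_extend hφ.continuousAt b V
  have aW := covAlong_eq_sum cov b hW v
  have aV := covAlong_eq_sum cov b hV v
  set w := fun i q => coordFunctional b i ((trivializationAt E (TangentSpace I : N → Type _) (φ p))
          (⟨φ q, W q⟩ : TangentBundle I N)).2
  set x := fun i q => coordFunctional b i ((trivializationAt E (TangentSpace I : N → Type _) (φ p))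
          (⟨φ q, V q⟩ : TangentBundle I N)).2
  have he : ∀ i, MDifferentiableAt I (I.prod 𝓘(ℝ, E))
      (fun z => (⟨z, FiberBundle.extend E (b i) z⟩ : TangentBundle I N)) (φ p) :=
    fun i => FiberBundle.mdifferentiableAt_extend I E (b i)
  have hg : ∀ i j, MDifferentiableAt I 𝓘(ℝ) (fun z => (inner ℝ (FiberBundle.extend E (b i) z)
      (FiberBundle.extend E (b j) z) : ℝ)) (φ p) := fun i j =>
    MDifferentiableAt.inner_bundle (E := (TangentSpace I : N → Type _)) (F := E) (he i) (he j)
  have hgφ : ∀ i j, MDifferentiableAt K 𝓘(ℝ) (fun q => (inner ℝ (FiberBundle.extend E (b i) (φ q))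
      (FiberBundle.extend E (b j) (φ q)) : ℝ)) p := fun i j => (hg i j).comp p hφ
  have h1 : (fun q => (inner ℝ (W q) (V q) : ℝ)) =ᶠ[𝓝 p] fun q => ∑ i, ∑ j, w i q * x j q *
      (inner ℝ (FiberBundle.extend E (b i) (φ q)) (FiberBundle.extend E (b j) (φ q)) : ℝ) := by
    filter_upwards [eW, eV] with q hq hq'
    conv_lhs => rw [hq, hq']
    rw [sum_inner]
    refine Finset.sum_congr rfl fun i _ => ?_
    rw [inner_sum]
    refine Finset.sum_congr rfl fun j _ => ?_
    rw [real_inner_smul_left, real_inner_smul_right]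
    ring
  have h2 : mvfderiv K (fun q => (inner ℝ (W q) (V q) : ℝ)) p v =
      mvfderiv K (fun q => ∑ i, ∑ j, w i q * x j q * (inner ℝ (FiberBundle.extend E (b i) (φ q))
        (FiberBundle.extend E (b j) (φ q)) : ℝ)) p v := by
    simp only [mvfderiv]
    rw [h1.mfderiv_eq]
    rfl
  have h3 : ∀ i j, mvfderiv K (fun q => (inner ℝ (FiberBundle.extend E (b i) (φ q))
      (FiberBundle.extend E (b j) (φ q)) : ℝ)) p v =
      inner ℝ (cov (FiberBundle.extend E (b i)) (φ p) (mfderiv K I φ p v)) (b j)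
      + inner ℝ (b i) (cov (FiberBundle.extend E (b j)) (φ p) (mfderiv K I φ p v)) := by
    intro i j
    have h4 := mfderiv_comp_apply p (hg i j) hφ v
    have h5 := hcov.metric _ _ (φ p) (he i) (he j) (mfderiv K I φ p v)
    simp only [FiberBundle.extend_apply_self] at h5
    rw [← h5]
    exact h4
  have h4 := mvfderiv_sum_sum_mul hw hv hgφ v
  have e1 : inner ℝ (covAlong K cov φ W p v) (V p)
      = (inner ℝ (covAlong K cov φ W p v) (∑ j, x j p • b j) : ℝ) :=
    congrArg (inner ℝ _) (eV.self_of_nhds.trans (by simp only [FiberBundle.extend_apply_self, x]))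
  have e2 : inner ℝ (W p) (covAlong K cov φ V p v)
      = (inner ℝ (∑ i, w i p • b i) (covAlong K cov φ V p v) : ℝ) :=
    congrArg (fun u => inner ℝ u _)
      (eW.self_of_nhds.trans (by simp only [FiberBundle.extend_apply_self, w]))
  rw [h2, h4, e1, e2, aW, aV]
  simp only [FiberBundle.extend_apply_self, h3]
  rw [sum_inner, sum_inner, ← Finset.sum_add_distrib]
  refine Finset.sum_congr rfl fun i _ => ?_
  rw [inner_sum, inner_sum, ← Finset.sum_add_distrib]
  refine Finset.sum_congr rfl fun j _ => ?_
  simp only [inner_add_left, inner_add_right, real_inner_smul_left, real_inner_smul_right]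
  ring

omit [IsContMDiffRiemannianBundle I ∞ E (fun x : N => TangentSpace I x)] in
/-- The connection along a map commutes with a parallel complex structure. -/
lemma IsKaehler.covAlong_J {J : ∀ x : N, TangentSpace I x →L[ℝ] TangentSpace I x}
    (hN : IsKaehler cov J) {φ : M → N}
    {W : ∀ p : M, TangentSpace I (φ p)} {p : M}
    (hW : MDifferentiableAt K (I.prod 𝓘(ℝ, E)) (fun q => (⟨φ q, W q⟩ : TangentBundle I N)) p)
    (v : TangentSpace K p) :
    covAlong K cov φ (fun q => J (φ q) (W q)) p v = J (φ p) (covAlong K cov φ W p v) := by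
  set b := Module.finBasis ℝ (TangentSpace I (φ p))
  have hφ := mdifferentiableAt_of_totalSpace hW
  have hw := mdifferentiableAt_coord_section b hW
  have he : ∀ i, MDifferentiableAt I (I.prod 𝓘(ℝ, E))
      (fun z => (⟨z, FiberBundle.extend E (b i) z⟩ : TangentBundle I N)) (φ p) :=
    fun i => FiberBundle.mdifferentiableAt_extend I E (b i)
  have hJe : ∀ i, MDifferentiableAt I (I.prod 𝓘(ℝ, E))
      (fun z => (⟨z, J z (FiberBundle.extend E (b i) z)⟩ : TangentBundle I N)) (φ p) := fun i =>
    MDifferentiableAt.clm_bundle_apply (b := fun z : N => z)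
      (E₁ := (TangentSpace I : N → Type _)) (E₂ := (TangentSpace I : N → Type _))
      (F₁ := E) (F₂ := E) ((hN.smooth.mdifferentiable (by simp)) (φ p)) (he i)
  have h1 : ∀ᶠ q in 𝓝 p, J (φ q) (W q) = ∑ i, coordFunctional b i
      ((trivializationAt E (TangentSpace I : N → Type _) (φ p))
        (⟨φ q, W q⟩ : TangentBundle I N)).2 • J (φ q) (FiberBundle.extend E (b i) (φ q)) := by
    filter_upwards [eventually_eq_sum_extend hφ.continuousAt b W] with q hq
    conv_lhs => rw [hq]
    simp only [map_sum, map_smul]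
  rw [covAlong_congr cov h1, covAlong_sum_smul cov hφ hw hJe, covAlong_eq_sum cov b hW, map_sum]
  refine Finset.sum_congr rfl fun i _ => ?_
  rw [hN.parallel _ _ (he i), map_add, map_smul, map_smul, FiberBundle.extend_apply_self]

end AlongMap

/-! ### Symmetry of the connection along an immersion -/

section Symmetry

open Filter Topology

variable {E : Type*} [NormedAddCommGroup E] [NormedSpace ℝ E]
  {H : Type*} [TopologicalSpace H] {I : ModelWithCorners ℝ E H}
  {N : Type*} [TopologicalSpace N] [ChartedSpace H N] [IsManifold I ∞ N]
  {F : Type*} [NormedAddCommGroup F] [NormedSpace ℝ F]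
  {G : Type*} [TopologicalSpace G] {K : ModelWithCorners ℝ F G}
  {M : Type*} [TopologicalSpace M] [ChartedSpace G M] [IsManifold K ∞ M]

/-- In the chart at `y`, the vector field `extend E w` is constant. -/
lemma extend_eq_mfderivWithin_symm {y z : N} (hz : z ∈ (chartAt H y).source)
    (w : TangentSpace I y) :
    FiberBundle.extend E w z = mfderivWithin 𝓘(ℝ, E) I (extChartAt I y).symm (Set.range I)
      (extChartAt I y z) (mfderiv I 𝓘(ℝ, E) (extChartAt I y) y w) := by
  have h1 := TangentBundle.symmL_trivializationAt (𝕜 := ℝ) (I := I) hz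
  have h2 := TangentBundle.continuousLinearMapAt_trivializationAt (𝕜 := ℝ) (I := I)
    (mem_chart_source H y)
  have h3 : FiberBundle.extend E w z = (trivializationAt E (TangentSpace I : N → Type _) y).symmL ℝ z
      ((trivializationAt E (TangentSpace I : N → Type _) y).continuousLinearMapAt ℝ y w) := by
    rw [Trivialization.symmL_apply _ hz, Trivialization.continuousLinearMapAt_apply,
      Trivialization.linearMapAt_apply, if_pos (FiberBundle.mem_baseSet_trivializationAt' y)]
    rfl
  rw [h3, h1, h2]
  rfl

lemma trivializationAt_snd_eq_mfderiv {y z : N} (hz : z ∈ (chartAt H y).source)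
    (u : TangentSpace I z) :
    ((trivializationAt E (TangentSpace I : N → Type _) y) (⟨z, u⟩ : TangentBundle I N)).2
      = mfderiv I 𝓘(ℝ, E) (extChartAt I y) z u := by
  have h2 := TangentBundle.continuousLinearMapAt_trivializationAt (𝕜 := ℝ) (I := I) hz
  have h3 : ((trivializationAt E (TangentSpace I : N → Type _) y) (⟨z, u⟩ : TangentBundle I N)).2
      = (trivializationAt E (TangentSpace I : N → Type _) y).continuousLinearMapAt ℝ z u := by
    rw [Trivialization.continuousLinearMapAt_apply, Trivialization.linearMapAt_apply, if_pos]
    exact hz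
  rw [h3, h2]
  rfl

lemma mlieBracket_extend [CompleteSpace E] (y : N) (a b : TangentSpace I y) :
    VectorField.mlieBracket I (FiberBundle.extend E a) (FiberBundle.extend E b) y = 0 := by
  have h : ∀ w : TangentSpace I y,
      VectorField.mpullbackWithin 𝓘(ℝ, E) I (extChartAt I y).symm (FiberBundle.extend E w)
        (Set.range I) =ᶠ[𝓝[Set.range I] (extChartAt I y y)]
        fun _ => mfderiv I 𝓘(ℝ, E) (extChartAt I y) y w := by
    intro w
    filter_upwards [extChartAt_target_mem_nhdsWithin (I := I) y] with x hx
    have hz : (extChartAt I y).symm x ∈ (chartAt H y).source := by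
      rw [← extChartAt_source I]; exact (extChartAt I y).map_target hx
    have h1 := extend_eq_mfderivWithin_symm hz w
    rw [VectorField.mpullbackWithin_apply, h1, (extChartAt I y).right_inv hx]
    exact (isInvertible_mfderivWithin_extChartAt_symm hx).inverse_apply_eq.2 rfl
  rw [← VectorField.mlieBracketWithin_univ, VectorField.mlieBracketWithin_apply]
  rw [Set.preimage_univ, Set.univ_inter]
  have hmem : extChartAt I y y ∈ Set.range I := Set.mem_range_self _
  have h2 := Filter.EventuallyEq.lieBracketWithin_vectorField_eq_of_mem (𝕜 := ℝ) (h a) (h b) hmem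
  have h3 : ∀ (a' b' : E) (s : Set E) (x : E),
      VectorField.lieBracketWithin ℝ (fun _ => a') (fun _ => b') s x = 0 := by
    intro a' b' s x
    simp [VectorField.lieBracketWithin]
  exact (congrArg _ (h2.trans (h3 _ _ _ _))).trans (map_zero _)

/-- The vector field `dφ X` along `φ` is differentiable where `X` is. -/
lemma mdifferentiableAt_mfderiv_section {φ : M → N} (hφ : ContMDiff K I ∞ φ)
    {X : ∀ q : M, TangentSpace K q} {p : M}
    (hX : MDifferentiableAt K (K.prod 𝓘(ℝ, F)) (fun q => (⟨q, X q⟩ : TangentBundle K M)) p) :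
    MDifferentiableAt K (I.prod 𝓘(ℝ, E))
      (fun q => (⟨φ q, mfderiv K I φ q (X q)⟩ : TangentBundle I N)) p := by
  have h : ContMDiff K.tangent I.tangent ∞ (tangentMap K I φ) :=
    hφ.contMDiff_tangentMap (by simp)
  exact ((h.mdifferentiable (by simp)) (⟨p, X p⟩ : TangentBundle K M)).comp p hX

/-- In charts, `dφ (extend w)` is the derivative of `φ` in the constant direction `w`. -/
lemma eventually_trivialization_mfderiv_extend [K.Boundaryless] {φ : M → N}
    (hφ : ContMDiff K I ∞ φ) (p : M) (w : TangentSpace K p) :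
    ∀ᶠ q in 𝓝 p, ((trivializationAt E (TangentSpace I : N → Type _) (φ p))
        (⟨φ q, mfderiv K I φ q (FiberBundle.extend F w q)⟩ : TangentBundle I N)).2
      = fderiv ℝ (extChartAt I (φ p) ∘ φ ∘ (extChartAt K p).symm) (extChartAt K p q)
        (mfderiv K 𝓘(ℝ, F) (extChartAt K p) p w) := by
  have h1 : ∀ᶠ q in 𝓝 p, φ q ∈ (chartAt H (φ p)).source :=
    hφ.continuous.continuousAt.eventually
      ((chartAt H (φ p)).open_source.mem_nhds (mem_chart_source H _))
  filter_upwards [h1, (chartAt G p).open_source.mem_nhds (mem_chart_source G p)] with q hq hq'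
  have hqs : q ∈ (extChartAt K p).source := by rwa [extChartAt_source]
  have hinv := (extChartAt K p).left_inv hqs
  have hsymm : MDifferentiableAt 𝓘(ℝ, F) K (extChartAt K p).symm (extChartAt K p q) := by
    have := mdifferentiableWithinAt_extChartAt_symm (I := K) ((extChartAt K p).map_source hqs)
    rwa [K.range_eq_univ, mdifferentiableWithinAt_univ] at this
  have hφq : MDifferentiableAt K I φ q := hφ.mdifferentiable (by simp) q
  have hN : MDifferentiableAt I 𝓘(ℝ, E) (extChartAt I (φ p)) (φ q) :=
    mdifferentiableAt_extChartAt hq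
  rw [trivializationAt_snd_eq_mfderiv hq, extend_eq_mfderivWithin_symm hq' w, K.range_eq_univ,
    mfderivWithin_univ, ← mfderiv_eq_fderiv]
  have h2 := mfderiv_comp_apply_of_eq (I := 𝓘(ℝ, F)) (I' := K) (I'' := I) (extChartAt K p q) hφq
    hsymm hinv (mfderiv K 𝓘(ℝ, F) (extChartAt K p) p w)
  have hφs : MDifferentiableAt 𝓘(ℝ, F) I (φ ∘ (extChartAt K p).symm) (extChartAt K p q) :=
    MDifferentiableAt.comp_of_eq (extChartAt K p q) hφq hsymm hinv
  have h3 := mfderiv_comp_apply_of_eq (I := 𝓘(ℝ, F)) (I' := I) (I'' := 𝓘(ℝ, E)) (extChartAt K p q)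
    hN hφs (congrArg φ hinv) (mfderiv K 𝓘(ℝ, F) (extChartAt K p) p w)
  rw [h2] at h3
  exact h3.symm

omit [IsManifold I ∞ N] [IsManifold K ∞ M] in
lemma contDiffAt_written [K.Boundaryless] {φ : M → N}
    (hφ : ContMDiff K I ∞ φ) (p : M) :
    ContDiffAt ℝ ∞ (extChartAt I (φ p) ∘ φ ∘ (extChartAt K p).symm) (extChartAt K p p) := by
  have h := (contMDiffAt_iff.1 (hφ p)).2
  rwa [K.range_eq_univ, contDiffWithinAt_univ] at h

/-- The derivative at `p` of the components of `dφ (extend w)` is a second derivative of `φ`. -/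
lemma mvfderiv_trivialization_mfderiv_extend [K.Boundaryless] {φ : M → N}
    (hφ : ContMDiff K I ∞ φ) (p : M) (v w : TangentSpace K p) :
    mvfderiv K (fun q => ((trivializationAt E (TangentSpace I : N → Type _) (φ p))
        (⟨φ q, mfderiv K I φ q (FiberBundle.extend F w q)⟩ : TangentBundle I N)).2) p v
      = fderiv ℝ (fderiv ℝ (extChartAt I (φ p) ∘ φ ∘ (extChartAt K p).symm)) (extChartAt K p p)
        (mfderiv K 𝓘(ℝ, F) (extChartAt K p) p v) (mfderiv K 𝓘(ℝ, F) (extChartAt K p) p w) := by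
  set g := extChartAt I (φ p) ∘ φ ∘ (extChartAt K p).symm with hg
  have hgd : DifferentiableAt ℝ (fderiv ℝ g) (extChartAt K p p) :=
    ((contDiffAt_written hφ p).fderiv_right (m := 1)
      (by rw [one_add_one_eq_two]; exact ENat.LEInfty.out)).differentiableAt one_ne_zero
  set w' : F := mfderiv K 𝓘(ℝ, F) (extChartAt K p) p w with hw'
  have h1 : DifferentiableAt ℝ (fun c => fderiv ℝ g c w') (extChartAt K p p) :=
    hgd.clm_apply (differentiableAt_const _)
  have h2 := mfderiv_comp_apply p h1.mdifferentiableAt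
    (mdifferentiableAt_extChartAt (I := K) (mem_chart_source G p)) v
  have h3 : (fun q => ((trivializationAt E (TangentSpace I : N → Type _) (φ p))
        (⟨φ q, mfderiv K I φ q (FiberBundle.extend F w q)⟩ : TangentBundle I N)).2) =ᶠ[𝓝 p]
        (fun c => fderiv ℝ g c w') ∘ extChartAt K p :=
    eventually_trivialization_mfderiv_extend hφ p w
  have h4 : fderiv ℝ (fun c => fderiv ℝ g c w') (extChartAt K p p)
      = (fderiv ℝ (fderiv ℝ g) (extChartAt K p p)).flip w' := by
    rw [fderiv_clm_apply hgd (differentiableAt_const _)]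
    ext x
    simp
  rw [mfderiv_eq_fderiv, h4] at h2
  refine Eq.trans ?_ h2
  simp only [mvfderiv]
  rw [h3.mfderiv_eq]
  rfl

variable [FiniteDimensional ℝ E]
  [RiemannianBundle (fun x : N => TangentSpace I x)]
  [IsContMDiffRiemannianBundle I ∞ E (fun x : N => TangentSpace I x)]
  {cov : CovariantDerivative I E (TangentSpace I : N → Type _)}

omit [IsContMDiffRiemannianBundle I ∞ E (fun x : N => TangentSpace I x)] in
lemma IsLeviCivita.cov_extend_symm (hcov : IsLeviCivita cov) (y : N) (a b : TangentSpace I y) :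
    cov (FiberBundle.extend E a) y b = cov (FiberBundle.extend E b) y a := by
  have h := cov.torsion_apply_eq_extend b a
  rw [hcov.torsion_eq_zero, mlieBracket_extend] at h
  simp only [FiberBundle.extend_apply_self, sub_zero] at h
  exact (sub_eq_zero.1 h.symm)

omit [IsContMDiffRiemannianBundle I ∞ E (fun x : N => TangentSpace I x)] in
/-- `∇_v (dφ w) = ∇_w (dφ v)` for coordinate fields `v`, `w`: the Levi-Civita connection is torsion
free and second derivatives are symmetric. -/
lemma IsLeviCivita.covAlong_mfderiv_extend_symm [K.Boundaryless] (hcov : IsLeviCivita cov)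
    {φ : M → N} (hφ : ContMDiff K I ∞ φ) (p : M) (v w : TangentSpace K p) :
    covAlong K cov φ (fun q => mfderiv K I φ q (FiberBundle.extend F w q)) p v
      = covAlong K cov φ (fun q => mfderiv K I φ q (FiberBundle.extend F v q)) p w := by
  have h1 : cov (FiberBundle.extend E (mfderiv K I φ p (FiberBundle.extend F w p))) (φ p)
      (mfderiv K I φ p v) = cov (FiberBundle.extend E (mfderiv K I φ p (FiberBundle.extend F v p)))
      (φ p) (mfderiv K I φ p w) := by
    rw [FiberBundle.extend_apply_self, FiberBundle.extend_apply_self, hcov.cov_extend_symm]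
  unfold covAlong
  have h2 := ((contDiffAt_written hφ p).isSymmSndFDerivAt
    (by simpa using ENat.LEInfty.out)).eq
    (mfderiv K 𝓘(ℝ, F) (extChartAt K p) p v) (mfderiv K 𝓘(ℝ, F) (extChartAt K p) p w)
  rw [mvfderiv_trivialization_mfderiv_extend hφ, mvfderiv_trivialization_mfderiv_extend hφ]
  exact congrArg₂ (· + ·) (congrArg _ h2) h1

end Symmetry

/-! ### Symmetric bilinearity of the derivative of the differential -/

section BilinearForm

open Filter Topology

variable {E : Type*} [NormedAddCommGroup E] [NormedSpace ℝ E] [FiniteDimensional ℝ E]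
  {H : Type*} [TopologicalSpace H] {I : ModelWithCorners ℝ E H}
  {N : Type*} [TopologicalSpace N] [ChartedSpace H N] [IsManifold I ∞ N]
  [RiemannianBundle (fun x : N => TangentSpace I x)]
  {F : Type*} [NormedAddCommGroup F] [NormedSpace ℝ F]
  {G : Type*} [TopologicalSpace G] {K : ModelWithCorners ℝ F G}
  {M : Type*} [TopologicalSpace M] [ChartedSpace G M] [IsManifold K ∞ M]
  (cov : CovariantDerivative I E (TangentSpace I : N → Type _))

omit [FiniteDimensional ℝ E] [RiemannianBundle (fun x : N => TangentSpace I x)]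
  [IsManifold K ∞ M] in
lemma covAlong_add_smul {φ : M → N} (W : ∀ p : M, TangentSpace I (φ p)) (p : M)
    (r : ℝ) (v v' : TangentSpace K p) :
    covAlong K cov φ W p (v + r • v') = covAlong K cov φ W p v + r • covAlong K cov φ W p v' := by
  have h := fun a => (Trivialization.symmₗ_apply (R := ℝ)
    (trivializationAt E (TangentSpace I : N → Type _) (φ p))
    (FiberBundle.mem_baseSet_trivializationAt' (φ p)) a).symm
  simp only [covAlong, h, map_add, map_smul, smul_add]
  rw [add_add_add_comm]

variable {cov} [K.Boundaryless]

/-- `(v, w) ↦ ∇_v (dφ w)`, for coordinate fields `w`, is a symmetric bilinear map. -/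
lemma IsLeviCivita.exists_bilinear_covAlong (hcov : IsLeviCivita cov)
    {φ : M → N} (hφ : ContMDiff K I ∞ φ) (p : M) :
    ∃ B : TangentSpace K p →ₗ[ℝ] TangentSpace K p →ₗ[ℝ] TangentSpace I (φ p),
      (∀ v w, B v w = covAlong K cov φ
        (fun q => mfderiv K I φ q (FiberBundle.extend F w q)) p v) ∧ ∀ v w, B v w = B w v := by
  have hs := hcov.covAlong_mfderiv_extend_symm hφ p
  have h1 : ∀ (w v v' : TangentSpace K p) (r : ℝ), covAlong K cov φ
      (fun q => mfderiv K I φ q (FiberBundle.extend F w q)) p (v + r • v') = _ :=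
    fun w v v' r => covAlong_add_smul cov _ p r v v'
  have h0 : ∀ w : TangentSpace K p, covAlong K cov φ
      (fun q => mfderiv K I φ q (FiberBundle.extend F w q)) p 0 = 0 := by
    intro w
    have := h1 w 0 0 (-1)
    simpa using this
  refine ⟨LinearMap.mk₂ ℝ (fun v w => covAlong K cov φ
    (fun q => mfderiv K I φ q (FiberBundle.extend F w q)) p v) ?_ ?_ ?_ ?_, fun v w => rfl, hs⟩
  · intro v v' w
    simpa using h1 w v v' 1
  · intro r v w
    simpa [h0] using h1 w 0 v r
  · intro v w w'
    rw [hs v, hs v, hs v]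
    simpa using h1 v w w' 1
  · intro r v w
    rw [hs v, hs v]
    simpa [h0] using h1 v 0 w r

end BilinearForm

/-! ### Products and warped products -/

section Lifts

open Filter Topology

variable {E : Type*} [NormedAddCommGroup E] [NormedSpace ℝ E]
  {H : Type*} [TopologicalSpace H] {I : ModelWithCorners ℝ E H}
  {N : Type*} [TopologicalSpace N] [ChartedSpace H N]
  {E₁ : Type*} [NormedAddCommGroup E₁] [NormedSpace ℝ E₁]
  {H₁ : Type*} [TopologicalSpace H₁] {I₁ : ModelWithCorners ℝ E₁ H₁}
  {M₁ : Type*} [TopologicalSpace M₁] [ChartedSpace H₁ M₁]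
  {E₂ : Type*} [NormedAddCommGroup E₂] [NormedSpace ℝ E₂]
  {H₂ : Type*} [TopologicalSpace H₂] {I₂ : ModelWithCorners ℝ E₂ H₂}
  {M₂ : Type*} [TopologicalSpace M₂] [ChartedSpace H₂ M₂]

/-- The lift to `T_x (M₁ × M₂)` of a tangent vector of the first factor. -/
def liftLeft (I₁ : ModelWithCorners ℝ E₁ H₁) (I₂ : ModelWithCorners ℝ E₂ H₂) (x : M₁ × M₂) :
    TangentSpace I₁ x.1 →ₗ[ℝ] TangentSpace (I₁.prod I₂) x :=
  LinearMap.inl ℝ E₁ E₂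

/-- The lift to `T_x (M₁ × M₂)` of a tangent vector of the second factor. -/
def liftRight (I₁ : ModelWithCorners ℝ E₁ H₁) (I₂ : ModelWithCorners ℝ E₂ H₂) (x : M₁ × M₂) :
    TangentSpace I₂ x.2 →ₗ[ℝ] TangentSpace (I₁.prod I₂) x :=
  LinearMap.inr ℝ E₁ E₂

lemma mfderiv_fst_liftLeft (x : M₁ × M₂) (X : TangentSpace I₁ x.1) :
    mfderiv (I₁.prod I₂) I₁ Prod.fst x (liftLeft I₁ I₂ x X) = X := by
  rw [mfderiv_fst]; rfl

lemma mfderiv_fst_liftRight (x : M₁ × M₂) (Z : TangentSpace I₂ x.2) :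
    mfderiv (I₁.prod I₂) I₁ Prod.fst x (liftRight I₁ I₂ x Z) = 0 := by
  rw [mfderiv_fst]; rfl

lemma mfderiv_snd_liftLeft (x : M₁ × M₂) (X : TangentSpace I₁ x.1) :
    mfderiv (I₁.prod I₂) I₂ Prod.snd x (liftLeft I₁ I₂ x X) = 0 := by
  rw [mfderiv_snd]; rfl

lemma mfderiv_snd_liftRight (x : M₁ × M₂) (Z : TangentSpace I₂ x.2) :
    mfderiv (I₁.prod I₂) I₂ Prod.snd x (liftRight I₁ I₂ x Z) = Z := by
  rw [mfderiv_snd]; rfl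

lemma range_liftLeft_sup_range_liftRight (x : M₁ × M₂) :
    LinearMap.range (liftLeft I₁ I₂ x) ⊔ LinearMap.range (liftRight I₁ I₂ x) = ⊤ :=
  LinearMap.sup_range_inl_inr

lemma eq_liftLeft_of_mfderiv_snd_eq_zero (x : M₁ × M₂) (v : TangentSpace (I₁.prod I₂) x)
    (hv : mfderiv (I₁.prod I₂) I₂ Prod.snd x v = 0) :
    v = liftLeft I₁ I₂ x (mfderiv (I₁.prod I₂) I₁ Prod.fst x v) := by
  rw [mfderiv_snd] at hv
  rw [mfderiv_fst]
  exact Prod.ext rfl hv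

/-- The tangent vectors of the leaf `M₁ × {q}` are the lifts from the first factor. -/
lemma mfderiv_comp_prodMk_left {φ : M₁ × M₂ → N} {x : M₁ × M₂}
    (hφ : MDifferentiableAt (I₁.prod I₂) I φ x) (X : TangentSpace I₁ x.1) :
    mfderiv I₁ I (fun p => φ (p, x.2)) x.1 X
      = mfderiv (I₁.prod I₂) I φ x (liftLeft I₁ I₂ x X) := by
  have h := mfderiv_comp_apply (I := I₁) (I' := I₁.prod I₂) (I'' := I)
    (f := fun p : M₁ => (p, x.2)) x.1 hφ
    (mdifferentiableAt_id.prodMk mdifferentiableAt_const) X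
  rw [mfderiv_prod_left] at h
  exact h

lemma mfderiv_comp_prodMk_right {φ : M₁ × M₂ → N} {x : M₁ × M₂}
    (hφ : MDifferentiableAt (I₁.prod I₂) I φ x) (Z : TangentSpace I₂ x.2) :
    mfderiv I₂ I (fun q => φ (x.1, q)) x.2 Z
      = mfderiv (I₁.prod I₂) I φ x (liftRight I₁ I₂ x Z) := by
  have h := mfderiv_comp_apply (I := I₂) (I' := I₁.prod I₂) (I'' := I)
    (f := fun q : M₂ => (x.1, q)) x.2 hφ
    (mdifferentiableAt_const.prodMk mdifferentiableAt_id) Z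
  rw [mfderiv_prod_right] at h
  exact h

lemma mvfderiv_liftLeft {u : M₁ × M₂ → ℝ} {x : M₁ × M₂}
    (hu : MDifferentiableAt (I₁.prod I₂) 𝓘(ℝ) u x) (X : TangentSpace I₁ x.1) :
    mvfderiv (I₁.prod I₂) u x (liftLeft I₁ I₂ x X) = mvfderiv I₁ (fun p => u (p, x.2)) x.1 X :=
  (mfderiv_comp_prodMk_left hu X).symm

lemma mvfderiv_liftRight {u : M₁ × M₂ → ℝ} {x : M₁ × M₂}
    (hu : MDifferentiableAt (I₁.prod I₂) 𝓘(ℝ) u x) (Z : TangentSpace I₂ x.2) :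
    mvfderiv (I₁.prod I₂) u x (liftRight I₁ I₂ x Z) = mvfderiv I₂ (fun q => u (x.1, q)) x.2 Z :=
  (mfderiv_comp_prodMk_right hu Z).symm

lemma mvfderiv_eq_of_eventuallyEq {u u' : M₁ → ℝ} {x : M₁} (h : u =ᶠ[𝓝 x] u')
    (X : TangentSpace I₁ x) : mvfderiv I₁ u x X = mvfderiv I₁ u' x X := by
  simp only [mvfderiv]
  rw [h.mfderiv_eq]
  rfl

lemma mvfderiv_comp_of_hasDerivAt {u : M₁ → ℝ} {x : M₁} {g : ℝ → ℝ} {g' : ℝ}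
    (hu : MDifferentiableAt I₁ 𝓘(ℝ) u x) (hg : HasDerivAt g g' (u x)) (X : TangentSpace I₁ x) :
    mvfderiv I₁ (fun p => g (u p)) x X = g' * mvfderiv I₁ u x X := by
  have h := mfderiv_comp_apply x hg.differentiableAt.mdifferentiableAt hu X
  rw [mfderiv_eq_fderiv, hg.hasFDerivAt.fderiv] at h
  exact h.trans (mul_comm (mvfderiv I₁ u x X) g')

lemma exists_J_mfderiv_liftLeft {J : ∀ x : N, TangentSpace I x →L[ℝ] TangentSpace I x}
    {φ : M₁ × M₂ → N} (hT : ∀ q : M₂, IsHolomorphicSubmanifold I₁ J (fun p : M₁ => φ (p, q)))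
    {x : M₁ × M₂} (hφ : MDifferentiableAt (I₁.prod I₂) I φ x) (X : TangentSpace I₁ x.1) :
    ∃ Y : TangentSpace I₁ x.1, J (φ x) (mfderiv (I₁.prod I₂) I φ x (liftLeft I₁ I₂ x X))
      = mfderiv (I₁.prod I₂) I φ x (liftLeft I₁ I₂ x Y) := by
  obtain ⟨Y, hY⟩ := hT x.2 x.1 (mfderiv I₁ I (fun p => φ (p, x.2)) x.1 X) ⟨X, rfl⟩
  refine ⟨Y, ?_⟩
  rw [← mfderiv_comp_prodMk_left hφ, ← mfderiv_comp_prodMk_left hφ]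
  exact hY.symm

end Lifts

section Product

open Filter Topology

variable {E₁ : Type*} [NormedAddCommGroup E₁] [NormedSpace ℝ E₁]
  {H₁ : Type*} [TopologicalSpace H₁] {I₁ : ModelWithCorners ℝ E₁ H₁}
  {M₁ : Type*} [TopologicalSpace M₁] [ChartedSpace H₁ M₁] [IsManifold I₁ ∞ M₁]
  {E₂ : Type*} [NormedAddCommGroup E₂] [NormedSpace ℝ E₂]
  {H₂ : Type*} [TopologicalSpace H₂] {I₂ : ModelWithCorners ℝ E₂ H₂}
  {M₂ : Type*} [TopologicalSpace M₂] [ChartedSpace H₂ M₂] [IsManifold I₂ ∞ M₂]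

lemma trivializationAt_snd_extend {y z : M₁}
    (w : TangentSpace I₁ y) (hz : z ∈ (chartAt H₁ y).source) :
    ((trivializationAt E₁ (TangentSpace I₁ : M₁ → Type _) y)
      (⟨z, FiberBundle.extend E₁ w z⟩ : TangentBundle I₁ M₁)).2
      = ((trivializationAt E₁ (TangentSpace I₁ : M₁ → Type _) y)
      (⟨y, w⟩ : TangentBundle I₁ M₁)).2 := by
  simp only [FiberBundle.extend]
  rw [Trivialization.apply_mk_symm _ hz]

lemma eq_extend_of_trivializationAt_snd_eq {y z : M₁} (w : TangentSpace I₁ y)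
    (hz : z ∈ (chartAt H₁ y).source) (u : TangentSpace I₁ z)
    (h : ((trivializationAt E₁ (TangentSpace I₁ : M₁ → Type _) y)
      (⟨z, u⟩ : TangentBundle I₁ M₁)).2 = ((trivializationAt E₁ (TangentSpace I₁ : M₁ → Type _) y)
      (⟨y, w⟩ : TangentBundle I₁ M₁)).2) :
    u = FiberBundle.extend E₁ w z := by
  simp only [FiberBundle.extend]
  rw [← h]
  exact (Trivialization.symm_apply_apply_mk _ hz u).symm

lemma extend_zero {y z : M₁} (hz : z ∈ (chartAt H₁ y).source) :
    FiberBundle.extend E₁ (0 : TangentSpace I₁ y) z = 0 := by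
  rw [extend_eq_mfderivWithin_symm hz, map_zero]
  exact map_zero _

lemma mfderiv_fst_extend (y z : M₁ × M₂) (hz : z ∈ (chartAt (ModelProd H₁ H₂) y).source)
    (v : TangentSpace (I₁.prod I₂) y) :
    mfderiv (I₁.prod I₂) I₁ Prod.fst z (FiberBundle.extend (E₁ × E₂) v z)
      = FiberBundle.extend E₁ (mfderiv (I₁.prod I₂) I₁ Prod.fst y v) z.1 := by
  have key : ∀ (z : M₁ × M₂) (_ : z ∈ (chartAt (ModelProd H₁ H₂) y).source)
      (u : TangentSpace (I₁.prod I₂) z),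
      ((trivializationAt E₁ (TangentSpace I₁ : M₁ → Type _) y.1)
        (⟨z.1, mfderiv (I₁.prod I₂) I₁ Prod.fst z u⟩ : TangentBundle I₁ M₁)).2
      = ((trivializationAt (E₁ × E₂) (TangentSpace (I₁.prod I₂) : M₁ × M₂ → Type _) y)
        (⟨z, u⟩ : TangentBundle (I₁.prod I₂) (M₁ × M₂))).2.1 := by
    intro z hz u
    have hz1 : z.1 ∈ (chartAt H₁ y.1).source := hz.1
    rw [trivializationAt_snd_eq_mfderiv hz1, trivializationAt_snd_eq_mfderiv hz]
    have h1 := mfderiv_comp_apply (I := I₁.prod I₂) (I' := I₁) (I'' := 𝓘(ℝ, E₁)) (f := Prod.fst) z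
      (mdifferentiableAt_extChartAt (I := I₁) hz1) mdifferentiableAt_fst u
    have h2 := mfderiv_comp_apply (I := I₁.prod I₂) (I' := 𝓘(ℝ, E₁ × E₂)) (I'' := 𝓘(ℝ, E₁)) z
      (ContinuousLinearMap.fst ℝ E₁ E₂).mdifferentiableAt
      (mdifferentiableAt_extChartAt (I := I₁.prod I₂) hz) u
    rw [ContinuousLinearMap.mfderiv_eq] at h2
    exact h1.symm.trans h2
  refine eq_extend_of_trivializationAt_snd_eq _ hz.1 _ ?_
  rw [key z hz, key y (mem_chart_source _ y)]
  exact congrArg Prod.fst (trivializationAt_snd_extend v hz)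

lemma mfderiv_snd_extend (y z : M₁ × M₂) (hz : z ∈ (chartAt (ModelProd H₁ H₂) y).source)
    (v : TangentSpace (I₁.prod I₂) y) :
    mfderiv (I₁.prod I₂) I₂ Prod.snd z (FiberBundle.extend (E₁ × E₂) v z)
      = FiberBundle.extend E₂ (mfderiv (I₁.prod I₂) I₂ Prod.snd y v) z.2 := by
  have key : ∀ (z : M₁ × M₂) (_ : z ∈ (chartAt (ModelProd H₁ H₂) y).source)
      (u : TangentSpace (I₁.prod I₂) z),
      ((trivializationAt E₂ (TangentSpace I₂ : M₂ → Type _) y.2)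
        (⟨z.2, mfderiv (I₁.prod I₂) I₂ Prod.snd z u⟩ : TangentBundle I₂ M₂)).2
      = ((trivializationAt (E₁ × E₂) (TangentSpace (I₁.prod I₂) : M₁ × M₂ → Type _) y)
        (⟨z, u⟩ : TangentBundle (I₁.prod I₂) (M₁ × M₂))).2.2 := by
    intro z hz u
    have hz2 : z.2 ∈ (chartAt H₂ y.2).source := hz.2
    rw [trivializationAt_snd_eq_mfderiv hz2, trivializationAt_snd_eq_mfderiv hz]
    have h1 := mfderiv_comp_apply (I := I₁.prod I₂) (I' := I₂) (I'' := 𝓘(ℝ, E₂)) (f := Prod.snd) z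
      (mdifferentiableAt_extChartAt (I := I₂) hz2) mdifferentiableAt_snd u
    have h2 := mfderiv_comp_apply (I := I₁.prod I₂) (I' := 𝓘(ℝ, E₁ × E₂)) (I'' := 𝓘(ℝ, E₂)) z
      (ContinuousLinearMap.snd ℝ E₁ E₂).mdifferentiableAt
      (mdifferentiableAt_extChartAt (I := I₁.prod I₂) hz) u
    rw [ContinuousLinearMap.mfderiv_eq] at h2
    exact h1.symm.trans h2
  refine eq_extend_of_trivializationAt_snd_eq _ hz.2 _ ?_
  rw [key z hz, key y (mem_chart_source _ y)]
  exact congrArg Prod.snd (trivializationAt_snd_extend v hz)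

lemma extend_liftLeft (x y : M₁ × M₂) (hy : y ∈ (chartAt (ModelProd H₁ H₂) x).source)
    (X : TangentSpace I₁ x.1) :
    FiberBundle.extend (E₁ × E₂) (liftLeft I₁ I₂ x X) y
      = liftLeft I₁ I₂ y (FiberBundle.extend E₁ X y.1) := by
  have h1 := mfderiv_fst_extend x y hy (liftLeft I₁ I₂ x X)
  have h2 := mfderiv_snd_extend x y hy (liftLeft I₁ I₂ x X)
  rw [mfderiv_snd_liftLeft, extend_zero hy.2] at h2
  rw [mfderiv_fst_liftLeft] at h1
  rw [eq_liftLeft_of_mfderiv_snd_eq_zero y _ h2, h1]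

lemma extend_liftRight (x y : M₁ × M₂) (hy : y ∈ (chartAt (ModelProd H₁ H₂) x).source)
    (Z : TangentSpace I₂ x.2) :
    FiberBundle.extend (E₁ × E₂) (liftRight I₁ I₂ x Z) y
      = liftRight I₁ I₂ y (FiberBundle.extend E₂ Z y.2) := by
  have h1 := mfderiv_fst_extend x y hy (liftRight I₁ I₂ x Z)
  have h2 := mfderiv_snd_extend x y hy (liftRight I₁ I₂ x Z)
  rw [mfderiv_fst_liftRight, extend_zero hy.1, mfderiv_fst] at h1
  rw [mfderiv_snd_liftRight, mfderiv_snd] at h2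
  exact Prod.ext h1 h2

end Product

section Warped

open Filter Topology

variable {E : Type*} [NormedAddCommGroup E] [NormedSpace ℝ E] [FiniteDimensional ℝ E]
  {H : Type*} [TopologicalSpace H] {I : ModelWithCorners ℝ E H}
  {N : Type*} [TopologicalSpace N] [ChartedSpace H N] [IsManifold I ∞ N]
  [RiemannianBundle (fun x : N => TangentSpace I x)]
  {E₁ : Type*} [NormedAddCommGroup E₁] [NormedSpace ℝ E₁]
  {H₁ : Type*} [TopologicalSpace H₁] {I₁ : ModelWithCorners ℝ E₁ H₁}
  {M₁ : Type*} [TopologicalSpace M₁] [ChartedSpace H₁ M₁] [IsManifold I₁ ∞ M₁]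
  [RiemannianBundle (fun x : M₁ => TangentSpace I₁ x)]
  {E₂ : Type*} [NormedAddCommGroup E₂] [NormedSpace ℝ E₂]
  {H₂ : Type*} [TopologicalSpace H₂] {I₂ : ModelWithCorners ℝ E₂ H₂}
  {M₂ : Type*} [TopologicalSpace M₂] [ChartedSpace H₂ M₂] [IsManifold I₂ ∞ M₂]
  [RiemannianBundle (fun x : M₂ => TangentSpace I₂ x)]

variable [RiemannianBundle (fun x : M₁ × M₂ => TangentSpace (I₁.prod I₂) x)] {f : M₁ → ℝ}

omit [IsManifold I₁ ∞ M₁] [IsManifold I₂ ∞ M₂] in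
lemma IsWarpedProduct.inner_liftLeft_liftRight (hM : IsWarpedProduct I₁ I₂ (B := M₁) (F := M₂) f)
    (x : M₁ × M₂) (X : TangentSpace I₁ x.1) (Z : TangentSpace I₂ x.2) :
    inner ℝ (liftLeft I₁ I₂ x X) (liftRight I₁ I₂ x Z) = 0 := by
  rw [hM.metric, mfderiv_fst_liftRight, mfderiv_snd_liftLeft]
  simp

omit [IsManifold I₁ ∞ M₁] [IsManifold I₂ ∞ M₂] in
lemma IsWarpedProduct.inner_liftLeft_liftLeft (hM : IsWarpedProduct I₁ I₂ (B := M₁) (F := M₂) f)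
    (x : M₁ × M₂) (X Y : TangentSpace I₁ x.1) :
    inner ℝ (liftLeft I₁ I₂ x X) (liftLeft I₁ I₂ x Y) = inner ℝ X Y := by
  rw [hM.metric, mfderiv_fst_liftLeft, mfderiv_fst_liftLeft, mfderiv_snd_liftLeft]
  simp

omit [IsManifold I₁ ∞ M₁] [IsManifold I₂ ∞ M₂] in
lemma IsWarpedProduct.inner_liftRight_liftRight (hM : IsWarpedProduct I₁ I₂ (B := M₁) (F := M₂) f)
    (x : M₁ × M₂) (Z W : TangentSpace I₂ x.2) :
    inner ℝ (liftRight I₁ I₂ x Z) (liftRight I₁ I₂ x W) = f x.1 ^ 2 * inner ℝ Z W := by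
  rw [hM.metric, mfderiv_fst_liftRight, mfderiv_snd_liftRight, mfderiv_snd_liftRight]
  simp

variable {φ : M₁ × M₂ → N}

omit [FiniteDimensional ℝ E] [IsManifold I ∞ N] in
lemma eventually_inner_left_right (hM : IsWarpedProduct I₁ I₂ (B := M₁) (F := M₂) f)
    (hφ : IsIsometricImmersion (I := I) (I₁.prod I₂) φ) (x : M₁ × M₂)
    (X : TangentSpace I₁ x.1) (Z : TangentSpace I₂ x.2) :
    ∀ᶠ y in 𝓝 x, inner ℝ
      (mfderiv (I₁.prod I₂) I φ y (FiberBundle.extend (E₁ × E₂) (liftLeft I₁ I₂ x X) y))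
      (mfderiv (I₁.prod I₂) I φ y (FiberBundle.extend (E₁ × E₂) (liftRight I₁ I₂ x Z) y)) = 0 := by
  filter_upwards [(chartAt (ModelProd H₁ H₂) x).open_source.mem_nhds (mem_chart_source _ x)]
    with y hy
  rw [hφ.isometric, extend_liftLeft x y hy, extend_liftRight x y hy, hM.inner_liftLeft_liftRight]

omit [FiniteDimensional ℝ E] [IsManifold I ∞ N] in
lemma mvfderiv_inner_left_right (hM : IsWarpedProduct I₁ I₂ (B := M₁) (F := M₂) f)
    (hφ : IsIsometricImmersion (I := I) (I₁.prod I₂) φ) (x : M₁ × M₂)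
    (X : TangentSpace I₁ x.1) (Z : TangentSpace I₂ x.2) (u : TangentSpace (I₁.prod I₂) x) :
    mvfderiv (I₁.prod I₂) (fun y => inner ℝ
      (mfderiv (I₁.prod I₂) I φ y (FiberBundle.extend (E₁ × E₂) (liftLeft I₁ I₂ x X) y))
      (mfderiv (I₁.prod I₂) I φ y (FiberBundle.extend (E₁ × E₂) (liftRight I₁ I₂ x Z) y))) x u
      = 0 := by
  rw [mvfderiv_eq_of_eventuallyEq (u' := fun _ => (0 : ℝ)) (eventually_inner_left_right hM hφ x X Z),
    mvfderiv_const]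
  rfl

omit [FiniteDimensional ℝ E] [IsManifold I ∞ N] in
lemma mvfderiv_inner_right_left (hM : IsWarpedProduct I₁ I₂ (B := M₁) (F := M₂) f)
    (hφ : IsIsometricImmersion (I := I) (I₁.prod I₂) φ) (x : M₁ × M₂)
    (X : TangentSpace I₁ x.1) (Z : TangentSpace I₂ x.2) (u : TangentSpace (I₁.prod I₂) x) :
    mvfderiv (I₁.prod I₂) (fun y => inner ℝ
      (mfderiv (I₁.prod I₂) I φ y (FiberBundle.extend (E₁ × E₂) (liftRight I₁ I₂ x Z) y))
      (mfderiv (I₁.prod I₂) I φ y (FiberBundle.extend (E₁ × E₂) (liftLeft I₁ I₂ x X) y))) x u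
      = 0 := by
  rw [← mvfderiv_inner_left_right hM hφ x X Z u]
  simp only [real_inner_comm]

variable [IsContMDiffRiemannianBundle I ∞ E (fun x : N => TangentSpace I x)]

omit [FiniteDimensional ℝ E] [RiemannianBundle fun x : M₁ => TangentSpace I₁ x]
  [RiemannianBundle fun x : M₂ => TangentSpace I₂ x] in
lemma mdifferentiableAt_inner_mfderiv_extend
    (hφ : IsIsometricImmersion (I := I) (I₁.prod I₂) φ) (x : M₁ × M₂)
    (v w : TangentSpace (I₁.prod I₂) x) :
    MDifferentiableAt (I₁.prod I₂) 𝓘(ℝ) (fun y => (inner ℝ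
      (mfderiv (I₁.prod I₂) I φ y (FiberBundle.extend (E₁ × E₂) v y))
      (mfderiv (I₁.prod I₂) I φ y (FiberBundle.extend (E₁ × E₂) w y)) : ℝ)) x := by
  have h := fun v : TangentSpace (I₁.prod I₂) x => mdifferentiableAt_mfderiv_section hφ.smooth
    (FiberBundle.mdifferentiableAt_extend (I₁.prod I₂) (E₁ × E₂) v)
  exact MDifferentiableAt.inner_bundle (h v) (h w)

omit [FiniteDimensional ℝ E] in
lemma mvfderiv_liftRight_inner_left_left (hM : IsWarpedProduct I₁ I₂ (B := M₁) (F := M₂) f)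
    (hφ : IsIsometricImmersion (I := I) (I₁.prod I₂) φ) (x : M₁ × M₂)
    (X Y : TangentSpace I₁ x.1) (Z : TangentSpace I₂ x.2) :
    mvfderiv (I₁.prod I₂) (fun y => inner ℝ
      (mfderiv (I₁.prod I₂) I φ y (FiberBundle.extend (E₁ × E₂) (liftLeft I₁ I₂ x X) y))
      (mfderiv (I₁.prod I₂) I φ y (FiberBundle.extend (E₁ × E₂) (liftLeft I₁ I₂ x Y) y))) x
      (liftRight I₁ I₂ x Z) = 0 := by
  rw [mvfderiv_liftRight (mdifferentiableAt_inner_mfderiv_extend hφ x _ _),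
    mvfderiv_eq_of_eventuallyEq (u' := fun _ => inner ℝ X Y), mvfderiv_const]
  · rfl
  filter_upwards [(chartAt H₂ x.2).open_source.mem_nhds (mem_chart_source _ x.2)] with q hq
  have hy : (x.1, q) ∈ (chartAt (ModelProd H₁ H₂) x).source := ⟨mem_chart_source _ x.1, hq⟩
  rw [hφ.isometric, extend_liftLeft x _ hy, extend_liftLeft x _ hy, hM.inner_liftLeft_liftLeft]
  simp

omit [IsManifold I₁ ∞ M₁] [IsManifold I₂ ∞ M₂] in
lemma IsWarpedProduct.mdifferentiableAt_log (hM : IsWarpedProduct I₁ I₂ (B := M₁) (F := M₂) f)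
    (x : M₁ × M₂) :
    MDifferentiableAt (I₁.prod I₂) 𝓘(ℝ) (fun y : M₁ × M₂ => Real.log (f y.1)) x := by
  have hf : MDifferentiableAt I₁ 𝓘(ℝ) f x.1 := hM.smooth.mdifferentiable (by simp) x.1
  have h1 : MDifferentiableAt I₁ 𝓘(ℝ) (fun p => Real.log (f p)) x.1 :=
    (Real.hasDerivAt_log (hM.pos x.1).ne').differentiableAt.mdifferentiableAt.comp _ hf
  exact h1.comp x mdifferentiableAt_fst

omit [IsManifold I₁ ∞ M₁] [IsManifold I₂ ∞ M₂] in
/-- `X (f²) = 2 (X ln f) f²`. -/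
lemma IsWarpedProduct.mvfderiv_sq_mul_const (hM : IsWarpedProduct I₁ I₂ (B := M₁) (F := M₂) f)
    (x : M₁ × M₂) (X : TangentSpace I₁ x.1) (c : ℝ) :
    mvfderiv I₁ (fun p => f p ^ 2 * c) x.1 X
      = 2 * mvfderiv (I₁.prod I₂) (fun y : M₁ × M₂ => Real.log (f y.1)) x (liftLeft I₁ I₂ x X)
        * (f x.1 ^ 2 * c) := by
  have hpos := hM.pos x.1
  have hf : MDifferentiableAt I₁ 𝓘(ℝ) f x.1 := hM.smooth.mdifferentiable (by simp) x.1
  have hl := Real.hasDerivAt_log hpos.ne'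
  have h3 : HasDerivAt (fun t : ℝ => t ^ 2 * c) (2 * f x.1 * c) (f x.1) := by
    simpa using (hasDerivAt_pow 2 (f x.1)).mul_const c
  rw [mvfderiv_liftLeft (hM.mdifferentiableAt_log x), mvfderiv_comp_of_hasDerivAt hf hl X,
    mvfderiv_comp_of_hasDerivAt hf h3 X]
  field_simp

omit [FiniteDimensional ℝ E] in
lemma mvfderiv_liftLeft_inner_right_right (hM : IsWarpedProduct I₁ I₂ (B := M₁) (F := M₂) f)
    (hφ : IsIsometricImmersion (I := I) (I₁.prod I₂) φ) (x : M₁ × M₂)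
    (X : TangentSpace I₁ x.1) (Z W : TangentSpace I₂ x.2) :
    mvfderiv (I₁.prod I₂) (fun y => inner ℝ
      (mfderiv (I₁.prod I₂) I φ y (FiberBundle.extend (E₁ × E₂) (liftRight I₁ I₂ x Z) y))
      (mfderiv (I₁.prod I₂) I φ y (FiberBundle.extend (E₁ × E₂) (liftRight I₁ I₂ x W) y))) x
      (liftLeft I₁ I₂ x X)
      = 2 * mvfderiv (I₁.prod I₂) (fun y : M₁ × M₂ => Real.log (f y.1)) x (liftLeft I₁ I₂ x X)
        * inner ℝ (liftRight I₁ I₂ x Z) (liftRight I₁ I₂ x W) := by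
  rw [mvfderiv_liftLeft (mdifferentiableAt_inner_mfderiv_extend hφ x _ _),
    mvfderiv_eq_of_eventuallyEq (u' := fun p => f p ^ 2 * inner ℝ Z W), hM.mvfderiv_sq_mul_const,
    hM.inner_liftRight_liftRight]
  filter_upwards [(chartAt H₁ x.1).open_source.mem_nhds (mem_chart_source _ x.1)] with p hp
  have hy : (p, x.2) ∈ (chartAt (ModelProd H₁ H₂) x).source := ⟨hp, mem_chart_source _ x.2⟩
  rw [hφ.isometric, extend_liftRight x _ hy, extend_liftRight x _ hy, hM.inner_liftRight_liftRight]
  simp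

variable {cov : CovariantDerivative I E (TangentSpace I : N → Type _)} [I₁.Boundaryless]
  [I₂.Boundaryless]

omit [RiemannianBundle fun x : M₁ => TangentSpace I₁ x]
  [RiemannianBundle fun x : M₂ => TangentSpace I₂ x] in
/-- The Koszul formula for coordinate fields. -/
lemma IsLeviCivita.two_mul_inner_covAlong_mfderiv_extend (hcov : IsLeviCivita cov)
    (hφ : IsIsometricImmersion (I := I) (I₁.prod I₂) φ) (x : M₁ × M₂)
    (u v w : TangentSpace (I₁.prod I₂) x) :
    2 * inner ℝ (covAlong (I₁.prod I₂) cov φ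
        (fun y => mfderiv (I₁.prod I₂) I φ y (FiberBundle.extend (E₁ × E₂) v y)) x u)
        (mfderiv (I₁.prod I₂) I φ x w)
      = mvfderiv (I₁.prod I₂) (fun y => inner ℝ
          (mfderiv (I₁.prod I₂) I φ y (FiberBundle.extend (E₁ × E₂) v y))
          (mfderiv (I₁.prod I₂) I φ y (FiberBundle.extend (E₁ × E₂) w y))) x u
        + mvfderiv (I₁.prod I₂) (fun y => inner ℝ
          (mfderiv (I₁.prod I₂) I φ y (FiberBundle.extend (E₁ × E₂) w y))
          (mfderiv (I₁.prod I₂) I φ y (FiberBundle.extend (E₁ × E₂) u y))) x v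
        - mvfderiv (I₁.prod I₂) (fun y => inner ℝ
          (mfderiv (I₁.prod I₂) I φ y (FiberBundle.extend (E₁ × E₂) u y))
          (mfderiv (I₁.prod I₂) I φ y (FiberBundle.extend (E₁ × E₂) v y))) x w := by
  have h := fun v : TangentSpace (I₁.prod I₂) x => mdifferentiableAt_mfderiv_section hφ.smooth
    (FiberBundle.mdifferentiableAt_extend (I₁.prod I₂) (E₁ × E₂) v)
  rw [hcov.mvfderiv_inner_covAlong (h v) (h w), hcov.mvfderiv_inner_covAlong (h w) (h u),
    hcov.mvfderiv_inner_covAlong (h u) (h v), hcov.covAlong_mfderiv_extend_symm hφ.smooth x v u,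
    hcov.covAlong_mfderiv_extend_symm hφ.smooth x w u,
    hcov.covAlong_mfderiv_extend_symm hφ.smooth x w v]
  simp only [FiberBundle.extend_apply_self, real_inner_comm]
  ring

/-- `⟨∇_X Z, W⟩ = (X ln f) ⟨Z, W⟩` on a warped product. -/
lemma inner_covAlong_left_right_right (hcov : IsLeviCivita cov)
    (hM : IsWarpedProduct I₁ I₂ (B := M₁) (F := M₂) f)
    (hφ : IsIsometricImmersion (I := I) (I₁.prod I₂) φ) (x : M₁ × M₂)
    (X : TangentSpace I₁ x.1) (Z W : TangentSpace I₂ x.2) :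
    inner ℝ (covAlong (I₁.prod I₂) cov φ (fun y => mfderiv (I₁.prod I₂) I φ y
        (FiberBundle.extend (E₁ × E₂) (liftRight I₁ I₂ x Z) y)) x (liftLeft I₁ I₂ x X))
        (mfderiv (I₁.prod I₂) I φ x (liftRight I₁ I₂ x W))
      = mvfderiv (I₁.prod I₂) (fun y : M₁ × M₂ => Real.log (f y.1)) x (liftLeft I₁ I₂ x X)
        * inner ℝ (liftRight I₁ I₂ x Z) (liftRight I₁ I₂ x W) := by
  have h := hcov.two_mul_inner_covAlong_mfderiv_extend hφ x (liftLeft I₁ I₂ x X)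
    (liftRight I₁ I₂ x Z) (liftRight I₁ I₂ x W)
  rw [mvfderiv_liftLeft_inner_right_right hM hφ, mvfderiv_inner_right_left hM hφ,
    mvfderiv_inner_left_right hM hφ] at h
  linarith

/-- `⟨∇_Z W, X⟩ = -(X ln f) ⟨Z, W⟩` on a warped product. -/
lemma inner_covAlong_right_right_left (hcov : IsLeviCivita cov)
    (hM : IsWarpedProduct I₁ I₂ (B := M₁) (F := M₂) f)
    (hφ : IsIsometricImmersion (I := I) (I₁.prod I₂) φ) (x : M₁ × M₂)
    (X : TangentSpace I₁ x.1) (Z W : TangentSpace I₂ x.2) :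
    inner ℝ (covAlong (I₁.prod I₂) cov φ (fun y => mfderiv (I₁.prod I₂) I φ y
        (FiberBundle.extend (E₁ × E₂) (liftRight I₁ I₂ x W) y)) x (liftRight I₁ I₂ x Z))
        (mfderiv (I₁.prod I₂) I φ x (liftLeft I₁ I₂ x X))
      = -(mvfderiv (I₁.prod I₂) (fun y : M₁ × M₂ => Real.log (f y.1)) x (liftLeft I₁ I₂ x X)
        * inner ℝ (liftRight I₁ I₂ x Z) (liftRight I₁ I₂ x W)) := by
  have h := hcov.two_mul_inner_covAlong_mfderiv_extend hφ x (liftRight I₁ I₂ x Z)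
    (liftRight I₁ I₂ x W) (liftLeft I₁ I₂ x X)
  rw [mvfderiv_liftLeft_inner_right_right hM hφ, mvfderiv_inner_right_left hM hφ,
    mvfderiv_inner_left_right hM hφ] at h
  linarith

/-- `⟨∇_X Y, W⟩ = 0` on a warped product: the leaves of the base are totally geodesic. -/
lemma inner_covAlong_left_left_right (hcov : IsLeviCivita cov)
    (hM : IsWarpedProduct I₁ I₂ (B := M₁) (F := M₂) f)
    (hφ : IsIsometricImmersion (I := I) (I₁.prod I₂) φ) (x : M₁ × M₂)
    (X Y : TangentSpace I₁ x.1) (W : TangentSpace I₂ x.2) :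
    inner ℝ (covAlong (I₁.prod I₂) cov φ (fun y => mfderiv (I₁.prod I₂) I φ y
        (FiberBundle.extend (E₁ × E₂) (liftLeft I₁ I₂ x Y) y)) x (liftLeft I₁ I₂ x X))
        (mfderiv (I₁.prod I₂) I φ x (liftRight I₁ I₂ x W)) = 0 := by
  have h := hcov.two_mul_inner_covAlong_mfderiv_extend hφ x (liftLeft I₁ I₂ x X)
    (liftLeft I₁ I₂ x Y) (liftRight I₁ I₂ x W)
  rw [mvfderiv_liftRight_inner_left_left hM hφ, mvfderiv_inner_right_left hM hφ,
    mvfderiv_inner_left_right hM hφ] at h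
  linarith

omit [I₁.Boundaryless] [I₂.Boundaryless] [FiniteDimensional ℝ E] [IsManifold I ∞ N]
  [IsContMDiffRiemannianBundle I ∞ E (fun x : N => TangentSpace I x)] in
lemma eventually_inner_J_left_right (hM : IsWarpedProduct I₁ I₂ (B := M₁) (F := M₂) f)
    (hφ : IsIsometricImmersion (I := I) (I₁.prod I₂) φ)
    {J : ∀ x : N, TangentSpace I x →L[ℝ] TangentSpace I x}
    (hT : ∀ q : M₂, IsHolomorphicSubmanifold I₁ J (fun p : M₁ => φ (p, q))) (x : M₁ × M₂)
    (X : TangentSpace I₁ x.1) (Z : TangentSpace I₂ x.2) :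
    ∀ᶠ y in 𝓝 x, inner ℝ (J (φ y)
      (mfderiv (I₁.prod I₂) I φ y (FiberBundle.extend (E₁ × E₂) (liftLeft I₁ I₂ x X) y)))
      (mfderiv (I₁.prod I₂) I φ y (FiberBundle.extend (E₁ × E₂) (liftRight I₁ I₂ x Z) y)) = 0 := by
  filter_upwards [(chartAt (ModelProd H₁ H₂) x).open_source.mem_nhds (mem_chart_source _ x)]
    with y hy
  obtain ⟨Y, hY⟩ := exists_J_mfderiv_liftLeft hT (hφ.smooth.mdifferentiable (by simp) y)
    (FiberBundle.extend E₁ X y.1)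
  rw [extend_liftLeft x y hy, extend_liftRight x y hy, hY, hφ.isometric,
    hM.inner_liftLeft_liftRight]

/-- Differentiating `⟨JX, W⟩ = 0` along `Z`, with `J` parallel, gives
`⟨∇_X Z, JW⟩ = -(JX ln f) ⟨Z, W⟩`. -/
lemma inner_covAlong_left_right_J {J : ∀ x : N, TangentSpace I x →L[ℝ] TangentSpace I x}
    (hN : IsKaehler cov J)
    (hM : IsWarpedProduct I₁ I₂ (B := M₁) (F := M₂) f)
    (hφ : IsIsometricImmersion (I := I) (I₁.prod I₂) φ)
    (hT : ∀ q : M₂, IsHolomorphicSubmanifold I₁ J (fun p : M₁ => φ (p, q))) (x : M₁ × M₂)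
    (X Y : TangentSpace I₁ x.1) (Z W : TangentSpace I₂ x.2)
    (hXY : J (φ x) (mfderiv (I₁.prod I₂) I φ x (liftLeft I₁ I₂ x X))
      = mfderiv (I₁.prod I₂) I φ x (liftLeft I₁ I₂ x Y)) :
    inner ℝ (covAlong (I₁.prod I₂) cov φ (fun y => mfderiv (I₁.prod I₂) I φ y
        (FiberBundle.extend (E₁ × E₂) (liftRight I₁ I₂ x Z) y)) x (liftLeft I₁ I₂ x X))
        (J (φ x) (mfderiv (I₁.prod I₂) I φ x (liftRight I₁ I₂ x W)))
      = -(mvfderiv (I₁.prod I₂) (fun y : M₁ × M₂ => Real.log (f y.1)) x (liftLeft I₁ I₂ x Y)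
        * inner ℝ (liftRight I₁ I₂ x Z) (liftRight I₁ I₂ x W)) := by
  have h := fun v : TangentSpace (I₁.prod I₂) x => mdifferentiableAt_mfderiv_section hφ.smooth
    (FiberBundle.mdifferentiableAt_extend (I₁.prod I₂) (E₁ × E₂) v)
  have hJ : MDifferentiableAt (I₁.prod I₂) (I.prod 𝓘(ℝ, E)) (fun y => (⟨φ y, J (φ y)
      (mfderiv (I₁.prod I₂) I φ y (FiberBundle.extend (E₁ × E₂) (liftLeft I₁ I₂ x X) y))⟩ :
      TangentBundle I N)) x :=
    MDifferentiableAt.clm_bundle_apply (b := φ)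
      (E₁ := (TangentSpace I : N → Type _)) (E₂ := (TangentSpace I : N → Type _))
      (F₁ := E) (F₂ := E) ((hN.smooth.mdifferentiable (by simp) (φ x)).comp x
        (hφ.smooth.mdifferentiable (by simp) x)) (h _)
  have h1 := hN.leviCivita.mvfderiv_inner_covAlong hJ (h (liftRight I₁ I₂ x W))
    (liftRight I₁ I₂ x Z)
  rw [mvfderiv_eq_of_eventuallyEq (u' := fun _ => (0 : ℝ))
    (eventually_inner_J_left_right hM hφ hT x X W), mvfderiv_const, hN.covAlong_J (h _)] at h1
  simp only [FiberBundle.extend_apply_self] at h1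
  rw [hXY, real_inner_comm (F := TangentSpace I (φ x)) _ (mfderiv _ _ _ _ (liftLeft I₁ I₂ x Y)),
    inner_covAlong_right_right_left hN.leviCivita hM hφ,
    hN.leviCivita.covAlong_mfderiv_extend_symm hφ.smooth] at h1
  have h2 : ∀ a b : TangentSpace I (φ x), inner ℝ a (J (φ x) b) = -inner ℝ (J (φ x) a) b := by
    intro a b
    rw [← hN.isometry (φ x) a, hN.sq, inner_neg_right]
  rw [h2]
  have h3 : (0 : ℝ) = _ := h1
  linarith

end Warped

/-! ### Leaves of a product -/

section Leaves

open Filter Topology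

variable {E : Type*} [NormedAddCommGroup E] [NormedSpace ℝ E]
  {H : Type*} [TopologicalSpace H] {I : ModelWithCorners ℝ E H}
  {N : Type*} [TopologicalSpace N] [ChartedSpace H N]
  {E₁ : Type*} [NormedAddCommGroup E₁] [NormedSpace ℝ E₁]
  {H₁ : Type*} [TopologicalSpace H₁] {I₁ : ModelWithCorners ℝ E₁ H₁}
  {M₁ : Type*} [TopologicalSpace M₁] [ChartedSpace H₁ M₁]
  {E₂ : Type*} [NormedAddCommGroup E₂] [NormedSpace ℝ E₂]
  {H₂ : Type*} [TopologicalSpace H₂] {I₂ : ModelWithCorners ℝ E₂ H₂}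
  {M₂ : Type*} [TopologicalSpace M₂] [ChartedSpace H₂ M₂] {φ : M₁ × M₂ → N}

lemma exists_eq_liftLeft_add_liftRight (x : M₁ × M₂) (v : TangentSpace (I₁.prod I₂) x) :
    ∃ X Z, v = liftLeft I₁ I₂ x X + liftRight I₁ I₂ x Z := by
  have h : v ∈ LinearMap.range (liftLeft I₁ I₂ x) ⊔ LinearMap.range (liftRight I₁ I₂ x) := by
    rw [range_liftLeft_sup_range_liftRight]; exact Submodule.mem_top
  obtain ⟨_, ⟨X, rfl⟩, _, ⟨Z, rfl⟩, h⟩ := Submodule.mem_sup.1 h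
  exact ⟨X, Z, h.symm⟩

lemma tangentImage_leaf_left {x : M₁ × M₂} (hφ : MDifferentiableAt (I₁.prod I₂) I φ x) :
    tangentImage (I := I) I₁ (fun p => φ (p, x.2)) x.1
      = (LinearMap.range (liftLeft I₁ I₂ x)).map
        (mfderiv (I₁.prod I₂) I φ x : TangentSpace (I₁.prod I₂) x →ₗ[ℝ] TangentSpace I (φ x)) := by
  rw [← LinearMap.range_comp]
  exact congrArg LinearMap.range (LinearMap.ext fun X => mfderiv_comp_prodMk_left hφ X)

lemma tangentImage_leaf_right {x : M₁ × M₂} (hφ : MDifferentiableAt (I₁.prod I₂) I φ x) :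
    tangentImage (I := I) I₂ (fun q => φ (x.1, q)) x.2
      = (LinearMap.range (liftRight I₁ I₂ x)).map
        (mfderiv (I₁.prod I₂) I φ x : TangentSpace (I₁.prod I₂) x →ₗ[ℝ] TangentSpace I (φ x)) := by
  rw [← LinearMap.range_comp]
  exact congrArg LinearMap.range (LinearMap.ext fun X => mfderiv_comp_prodMk_right hφ X)

variable [IsManifold I ∞ N] [IsManifold I₁ ∞ M₁] [IsManifold I₂ ∞ M₂]
  {cov : CovariantDerivative I E (TangentSpace I : N → Type _)}

/-- The connection along a leaf is the connection along `φ`. -/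
lemma covAlong_leaf_left (hφ : ContMDiff (I₁.prod I₂) I ∞ φ) (x : M₁ × M₂)
    (X Y : TangentSpace I₁ x.1) :
    covAlong I₁ cov (fun p => φ (p, x.2)) (fun p => mfderiv I₁ I (fun p => φ (p, x.2)) p
        (FiberBundle.extend E₁ Y p)) x.1 X
      = covAlong (I₁.prod I₂) cov φ (fun y => mfderiv (I₁.prod I₂) I φ y
        (FiberBundle.extend (E₁ × E₂) (liftLeft I₁ I₂ x Y) y)) x
        (liftLeft I₁ I₂ x X) := by
  have h1 : ∀ᶠ p in 𝓝 x.1, mfderiv I₁ I (fun p => φ (p, x.2)) p (FiberBundle.extend E₁ Y p)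
      = mfderiv (I₁.prod I₂) I φ (p, x.2)
        (FiberBundle.extend (E₁ × E₂) (liftLeft I₁ I₂ x Y) (p, x.2)) := by
    filter_upwards [(chartAt H₁ x.1).open_source.mem_nhds (mem_chart_source _ x.1)] with p hp
    have hy : (p, x.2) ∈ (chartAt (ModelProd H₁ H₂) x).source := ⟨hp, mem_chart_source _ x.2⟩
    rw [extend_liftLeft x _ hy]
    exact mfderiv_comp_prodMk_left (x := (p, x.2)) (hφ.mdifferentiable (by simp) _) _
  rw [covAlong_congr cov h1]
  have h2 := covAlong_comp cov (K := I₁.prod I₂) (K' := I₁) (φ := φ) (κ := fun p => (p, x.2))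
    (p := x.1) (mdifferentiableAt_id.prodMk mdifferentiableAt_const)
    (mdifferentiableAt_mfderiv_section hφ (FiberBundle.mdifferentiableAt_extend (I₁.prod I₂)
      (E₁ × E₂) (liftLeft I₁ I₂ x Y))) X
  rw [mfderiv_prod_left] at h2
  exact h2

lemma covAlong_leaf_right (hφ : ContMDiff (I₁.prod I₂) I ∞ φ) (x : M₁ × M₂)
    (Z W : TangentSpace I₂ x.2) :
    covAlong I₂ cov (fun q => φ (x.1, q)) (fun q => mfderiv I₂ I (fun q => φ (x.1, q)) q
        (FiberBundle.extend E₂ W q)) x.2 Z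
      = covAlong (I₁.prod I₂) cov φ (fun y => mfderiv (I₁.prod I₂) I φ y
        (FiberBundle.extend (E₁ × E₂) (liftRight I₁ I₂ x W) y)) x
        (liftRight I₁ I₂ x Z) := by
  have h1 : ∀ᶠ q in 𝓝 x.2, mfderiv I₂ I (fun q => φ (x.1, q)) q (FiberBundle.extend E₂ W q)
      = mfderiv (I₁.prod I₂) I φ (x.1, q)
        (FiberBundle.extend (E₁ × E₂) (liftRight I₁ I₂ x W) (x.1, q)) := by
    filter_upwards [(chartAt H₂ x.2).open_source.mem_nhds (mem_chart_source _ x.2)] with q hq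
    have hy : (x.1, q) ∈ (chartAt (ModelProd H₁ H₂) x).source := ⟨mem_chart_source _ x.1, hq⟩
    rw [extend_liftRight x _ hy]
    exact mfderiv_comp_prodMk_right (x := (x.1, q)) (hφ.mdifferentiable (by simp) _) _
  rw [covAlong_congr cov h1]
  have h2 := covAlong_comp cov (K := I₁.prod I₂) (K' := I₂) (φ := φ) (κ := fun q => (x.1, q))
    (p := x.2) (mdifferentiableAt_const.prodMk mdifferentiableAt_id)
    (mdifferentiableAt_mfderiv_section hφ (FiberBundle.mdifferentiableAt_extend (I₁.prod I₂)
      (E₁ × E₂) (liftRight I₁ I₂ x W))) Z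
  rw [mfderiv_prod_right] at h2
  exact h2

end Leaves

section Gradient

variable {E : Type*} [NormedAddCommGroup E] [NormedSpace ℝ E]
  {H : Type*} [TopologicalSpace H] {I : ModelWithCorners ℝ E H}
  {N : Type*} [TopologicalSpace N] [ChartedSpace H N]
  [RiemannianBundle (fun x : N => TangentSpace I x)]
  {E₁ : Type*} [NormedAddCommGroup E₁] [NormedSpace ℝ E₁]
  {H₁ : Type*} [TopologicalSpace H₁] {I₁ : ModelWithCorners ℝ E₁ H₁}
  {M₁ : Type*} [TopologicalSpace M₁] [ChartedSpace H₁ M₁]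
  [RiemannianBundle (fun x : M₁ => TangentSpace I₁ x)]
  {E₂ : Type*} [NormedAddCommGroup E₂] [NormedSpace ℝ E₂]
  {H₂ : Type*} [TopologicalSpace H₂] {I₂ : ModelWithCorners ℝ E₂ H₂}
  {M₂ : Type*} [TopologicalSpace M₂] [ChartedSpace H₂ M₂]
  [RiemannianBundle (fun x : M₂ => TangentSpace I₂ x)]
  [RiemannianBundle (fun x : M₁ × M₂ => TangentSpace (I₁.prod I₂) x)] {f : M₁ → ℝ}
  {φ : M₁ × M₂ → N}

lemma inner_riemannianGradient [FiniteDimensional ℝ E₁] (u : M₁ → ℝ) (x : M₁) (v : TangentSpace I₁ x) :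
    inner ℝ (riemannianGradient I₁ u x) v = mvfderiv I₁ u x v :=
  InnerProductSpace.toDual_symm_apply

lemma IsWarpedProduct.mvfderiv_log_liftRight (hM : IsWarpedProduct I₁ I₂ (B := M₁) (F := M₂) f)
    (x : M₁ × M₂) (Z : TangentSpace I₂ x.2) :
    mvfderiv (I₁.prod I₂) (fun y : M₁ × M₂ => Real.log (f y.1)) x (liftRight I₁ I₂ x Z) = 0 := by
  rw [mvfderiv_liftRight (hM.mdifferentiableAt_log x)]
  exact congrArg (fun L : TangentSpace I₂ x.2 →L[ℝ] ℝ => L Z) (mvfderiv_const _)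

/-- A vector orthogonal to the second factor is tangent to the first. -/
lemma IsWarpedProduct.exists_eq_liftLeft (hM : IsWarpedProduct I₁ I₂ (B := M₁) (F := M₂) f)
    (x : M₁ × M₂) (v : TangentSpace (I₁.prod I₂) x)
    (hv : ∀ Z, inner ℝ v (liftRight I₁ I₂ x Z) = 0) : ∃ X, v = liftLeft I₁ I₂ x X := by
  obtain ⟨X, Z, rfl⟩ := exists_eq_liftLeft_add_liftRight x v
  have h := hv Z
  rw [inner_add_left, hM.inner_liftLeft_liftRight, zero_add] at h
  rw [inner_self_eq_zero.1 h, add_zero]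
  exact ⟨X, rfl⟩

/-- A vector orthogonal to the first factor is tangent to the second. -/
lemma IsWarpedProduct.exists_eq_liftRight (hM : IsWarpedProduct I₁ I₂ (B := M₁) (F := M₂) f)
    (x : M₁ × M₂) (v : TangentSpace (I₁.prod I₂) x)
    (hv : ∀ X, inner ℝ v (liftLeft I₁ I₂ x X) = 0) : ∃ Z, v = liftRight I₁ I₂ x Z := by
  obtain ⟨X, Z, rfl⟩ := exists_eq_liftLeft_add_liftRight x v
  have h := hv X
  rw [inner_add_left, real_inner_comm _ (liftRight I₁ I₂ x Z), hM.inner_liftLeft_liftRight,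
    add_zero] at h
  rw [inner_self_eq_zero.1 h, zero_add]
  exact ⟨Z, rfl⟩

/-- `∇ ln f` is tangent to the first factor. -/
lemma IsWarpedProduct.exists_gradient_eq_liftLeft [FiniteDimensional ℝ E₁]
    [FiniteDimensional ℝ E₂]
    (hM : IsWarpedProduct I₁ I₂ (B := M₁) (F := M₂) f) (x : M₁ × M₂) :
    ∃ X, riemannianGradient (I₁.prod I₂) (fun y : M₁ × M₂ => Real.log (f y.1)) x
      = liftLeft I₁ I₂ x X :=
  hM.exists_eq_liftLeft x _ fun Z => by
    rw [inner_riemannianGradient, hM.mvfderiv_log_liftRight]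

lemma IsWarpedProduct.mfderiv_gradient_mem_orthogonal
    [FiniteDimensional ℝ E₁] [FiniteDimensional ℝ E₂] (hM : IsWarpedProduct I₁ I₂ (B := M₁) (F := M₂) f)
    (hφ : IsIsometricImmersion (I := I) (I₁.prod I₂) φ) (x : M₁ × M₂) :
    mfderiv (I₁.prod I₂) I φ x
      (riemannianGradient (I₁.prod I₂) (fun y : M₁ × M₂ => Real.log (f y.1)) x)
      ∈ (tangentImage (I := I) I₂ (fun q => φ (x.1, q)) x.2)ᗮ := by
  rw [tangentImage_leaf_right (hφ.smooth.mdifferentiable (by simp) x)]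
  rintro _ ⟨_, ⟨Z, rfl⟩, rfl⟩
  refine (hφ.isometric x _ _).trans ?_
  rw [real_inner_comm, inner_riemannianGradient, hM.mvfderiv_log_liftRight]

end Gradient

/-! ### The second fundamental form of a warped product -/

section SecondFundamentalFormZero

variable {E : Type*} [NormedAddCommGroup E] [NormedSpace ℝ E] [FiniteDimensional ℝ E]
  {H : Type*} [TopologicalSpace H] {I : ModelWithCorners ℝ E H}
  {N : Type*} [TopologicalSpace N] [ChartedSpace H N] [IsManifold I ∞ N]
  [RiemannianBundle (fun x : N => TangentSpace I x)]
  {F : Type*} [NormedAddCommGroup F] [NormedSpace ℝ F]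
  {G : Type*} [TopologicalSpace G] {K : ModelWithCorners ℝ F G}
  {M : Type*} [TopologicalSpace M] [ChartedSpace G M] [IsManifold K ∞ M]
  {cov : CovariantDerivative I E (TangentSpace I : N → Type _)}

/-- Where the second fundamental form vanishes, the ambient derivative is tangent. -/
lemma exists_mfderiv_eq_of_secondFundamentalForm_eq_zero {φ : M → N} {p : M}
    {v w : TangentSpace K p} (h : secondFundamentalForm K cov φ p v w = 0) :
    ∃ u, mfderiv K I φ p u = covAlong K cov φ
      (fun y => mfderiv K I φ y (FiberBundle.extend F w y)) p v := by
  have h1 : covAlong K cov φ (fun y => mfderiv K I φ y (FiberBundle.extend F w y)) p v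
      ∈ tangentImage (I := I) K φ p := by
    rw [← Submodule.starProjection_eq_self_iff]
    exact (sub_eq_zero.1 h).symm
  exact h1

end SecondFundamentalFormZero

section SecondFundamentalForm

open Filter Topology

variable {E : Type*} [NormedAddCommGroup E] [NormedSpace ℝ E] [FiniteDimensional ℝ E]
  {H : Type*} [TopologicalSpace H] {I : ModelWithCorners ℝ E H}
  {N : Type*} [TopologicalSpace N] [ChartedSpace H N] [IsManifold I ∞ N]
  [RiemannianBundle (fun x : N => TangentSpace I x)]
  [IsContMDiffRiemannianBundle I ∞ E (fun x : N => TangentSpace I x)]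
  {E₁ : Type*} [NormedAddCommGroup E₁] [NormedSpace ℝ E₁] [FiniteDimensional ℝ E₁]
  {H₁ : Type*} [TopologicalSpace H₁] {I₁ : ModelWithCorners ℝ E₁ H₁} [I₁.Boundaryless]
  {M₁ : Type*} [TopologicalSpace M₁] [ChartedSpace H₁ M₁] [IsManifold I₁ ∞ M₁]
  [RiemannianBundle (fun x : M₁ => TangentSpace I₁ x)]
  {E₂ : Type*} [NormedAddCommGroup E₂] [NormedSpace ℝ E₂] [FiniteDimensional ℝ E₂]
  {H₂ : Type*} [TopologicalSpace H₂] {I₂ : ModelWithCorners ℝ E₂ H₂} [I₂.Boundaryless]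
  {M₂ : Type*} [TopologicalSpace M₂] [ChartedSpace H₂ M₂] [IsManifold I₂ ∞ M₂]
  [RiemannianBundle (fun x : M₂ => TangentSpace I₂ x)]
  [RiemannianBundle (fun x : M₁ × M₂ => TangentSpace (I₁.prod I₂) x)] {f : M₁ → ℝ}
  {φ : M₁ × M₂ → N} {cov : CovariantDerivative I E (TangentSpace I : N → Type _)}

/-- The estimate of `‖h‖²` at a point. The mixed part `h(X, Z)` contributes the bound, twice by the
symmetry of `h`, so equality forces the restrictions of `h` to the two factors to vanish. -/
theorem le_secondFundamentalFormNormSq {J : ∀ x : N, TangentSpace I x →L[ℝ] TangentSpace I x}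
    (hN : IsKaehler cov J) (hM : IsWarpedProduct I₁ I₂ (B := M₁) (F := M₂) f)
    (hφ : IsIsometricImmersion (I := I) (I₁.prod I₂) φ)
    (hT : ∀ q : M₂, IsHolomorphicSubmanifold I₁ J (fun p : M₁ => φ (p, q)))
    {θ : M₁ × M₂ → ℝ}
    (hθ : ∀ p : M₁, IsPointwiseSlant I₂ J (fun q : M₂ => φ (p, q)) (fun q => θ (p, q)))
    (x : M₁ × M₂) (hs : Real.sin (θ x) ≠ 0) :
    2 * (Module.finrank ℝ E₂ * ((1 / Real.sin (θ x)) ^ 2 + (Real.cos (θ x) / Real.sin (θ x)) ^ 2)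
        * ‖riemannianGradient (I₁.prod I₂) (fun y : M₁ × M₂ => Real.log (f y.1)) x‖ ^ 2)
      ≤ secondFundamentalFormNormSq (I₁.prod I₂) cov φ x ∧
    (secondFundamentalFormNormSq (I₁.prod I₂) cov φ x = 2 * (Module.finrank ℝ E₂ *
        ((1 / Real.sin (θ x)) ^ 2 + (Real.cos (θ x) / Real.sin (θ x)) ^ 2)
        * ‖riemannianGradient (I₁.prod I₂) (fun y : M₁ × M₂ => Real.log (f y.1)) x‖ ^ 2) →
      (∀ X Y, secondFundamentalForm (I₁.prod I₂) cov φ x (liftLeft I₁ I₂ x X)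
        (liftLeft I₁ I₂ x Y) = 0) ∧
      (∀ Z W, secondFundamentalForm (I₁.prod I₂) cov φ x (liftRight I₁ I₂ x Z)
        (liftRight I₁ I₂ x W) = 0) ∧
      meanCurvatureVector (I₁.prod I₂) cov φ x = 0) := by
  have hφx : MDifferentiableAt (I₁.prod I₂) I φ x := hφ.smooth.mdifferentiable (by simp) x
  obtain ⟨B, hB, hBs⟩ := hN.leviCivita.exists_bilinear_covAlong hφ.smooth x
  set ι : TangentSpace (I₁.prod I₂) x →ₗ[ℝ] TangentSpace I (φ x) :=
    (mfderiv (I₁.prod I₂) I φ x : TangentSpace (I₁.prod I₂) x →ₗ[ℝ] TangentSpace I (φ x)) with hι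
  set T := LinearMap.range (liftLeft I₁ I₂ x)
  set S := LinearMap.range (liftRight I₁ I₂ x)
  have hTS : ∀ v ∈ T, ∀ z ∈ S, inner ℝ v z = (0 : ℝ) := by
    rintro _ ⟨X, rfl⟩ _ ⟨Z, rfl⟩
    exact hM.inner_liftLeft_liftRight x X Z
  have hsup : T ⊔ S = ⊤ := range_liftLeft_sup_range_liftRight x
  set t := riemannianGradient (I₁.prod I₂) (fun y : M₁ × M₂ => Real.log (f y.1)) x with ht
  have htT : t ∈ T := by
    obtain ⟨X, hX⟩ := hM.exists_gradient_eq_liftLeft x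
    exact ⟨X, hX.symm⟩
  have hlam : ∀ v, mvfderiv (I₁.prod I₂) (fun y : M₁ × M₂ => Real.log (f y.1)) x v = inner ℝ v t :=
    fun v => by rw [real_inner_comm, ht, inner_riemannianGradient]
  have hslant : ∀ z ∈ S, ‖(S.map ι).starProjection (J (φ x) (ι z))‖ ^ 2
      = Real.cos (θ x) ^ 2 * ‖z‖ ^ 2 := by
    intro z hz
    have hnorm : ‖J (φ x) (ι z)‖ ^ 2 = ‖z‖ ^ 2 := by
      rw [← real_inner_self_eq_norm_sq, hN.isometry, ← real_inner_self_eq_norm_sq]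
      exact hφ.isometric x z z
    -- The slant condition speaks of nonzero vectors only.
    by_cases h0 : ι z = 0
    · rw [h0, map_zero, norm_zero] at hnorm
      rw [h0, map_zero, map_zero, ← hnorm, norm_zero]
      ring
    · have h1 := hθ x.1 x.2 (ι z)
      have h2 := tangentImage_leaf_right hφx
      have h3 := norm_sq_starProjection_of_angle_eq _
        (h1 (h2.symm ▸ Submodule.mem_map_of_mem hz) h0)
      rw [← hnorm]
      simp only [h2] at h3
      exact h3
  have hmixed := mixed_sum_norm_sq_le hTS hsup (stdOrthonormalBasis ℝ T) (stdOrthonormalBasis ℝ S)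
    ι (hφ.isometric x) (J (φ x) : TangentSpace I (φ x) →ₗ[ℝ] TangentSpace I (φ x)) (hN.sq (φ x))
    (hN.isometry (φ x)) (by
      rintro _ ⟨X, rfl⟩
      obtain ⟨Y, hY⟩ := exists_J_mfderiv_liftLeft hT hφx X
      exact ⟨_, ⟨Y, rfl⟩, hY⟩) (Real.sin_sq_add_cos_sq (θ x)) hs hslant B htT (by
      rintro _ ⟨X, rfl⟩ _ ⟨Z, rfl⟩ _ ⟨W, rfl⟩
      rw [hB, ← hlam]
      exact inner_covAlong_left_right_right hN.leviCivita hM hφ x X Z W) (by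
      rintro _ ⟨X, rfl⟩ _ ⟨Y, rfl⟩ hXY _ ⟨Z, rfl⟩ _ ⟨W, rfl⟩
      rw [hB, ← hlam, neg_mul]
      exact inner_covAlong_left_right_J hN hM hφ hT x X Y Z W hXY)
  have hcard : Fintype.card (Fin (Module.finrank ℝ S)) = Module.finrank ℝ E₂ := by
    rw [Fintype.card_fin]
    exact LinearMap.finrank_range_of_inj (f := LinearMap.inr ℝ E₁ E₂) LinearMap.inr_injective
  rw [hcard] at hmixed
  set Hf : TangentSpace (I₁.prod I₂) x →ₗ[ℝ] TangentSpace (I₁.prod I₂) x →ₗ[ℝ]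
      TangentSpace I (φ x) := B.compr₂ (LinearMap.id -
        ((LinearMap.range ι).starProjection : TangentSpace I (φ x) →ₗ[ℝ] TangentSpace I (φ x)))
    with hHf
  have hH : ∀ v w, Hf v w = secondFundamentalForm (I₁.prod I₂) cov φ x v w := by
    intro v w
    simp only [secondFundamentalForm, ← hB]
    rfl
  have hHs : ∀ v w, Hf v w = Hf w v := fun v w => by
    simp only [hHf, LinearMap.compr₂_apply, hBs v w]
  have hmain := two_mul_le_sum_sum_norm_sq hTS hsup
    (stdOrthonormalBasis ℝ (TangentSpace (I₁.prod I₂) x)) Hf hHs hmixed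
  have hsum : ∑ i, ∑ j, ‖Hf (stdOrthonormalBasis ℝ (TangentSpace (I₁.prod I₂) x) i)
      (stdOrthonormalBasis ℝ (TangentSpace (I₁.prod I₂) x) j)‖ ^ 2
      = secondFundamentalFormNormSq (I₁.prod I₂) cov φ x := by
    simp only [hH]
    rfl
  rw [hsum] at hmain
  refine ⟨hmain.1, fun h => ?_⟩
  obtain ⟨h1, h2⟩ := hmain.2 h
  refine ⟨fun X Y => ?_, fun Z W => ?_, ?_⟩
  · rw [← hH]; exact h1 _ ⟨X, rfl⟩ _ ⟨Y, rfl⟩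
  · rw [← hH]; exact h2 _ ⟨Z, rfl⟩ _ ⟨W, rfl⟩
  · have h3 := sum_diag_eq_zero_of_sup hTS hsup
      (stdOrthonormalBasis ℝ (TangentSpace (I₁.prod I₂) x)) Hf h1 h2
    simp only [hH] at h3
    simp only [meanCurvatureVector]
    exact (congrArg _ h3).trans (smul_zero _)

omit [FiniteDimensional ℝ E₁] [FiniteDimensional ℝ E₂] in
/-- Leaves `M₁ × {q}` on which `h` vanishes are totally geodesic: they are so in the warped
product. -/
theorem secondFundamentalForm_leaf_left (hcov : IsLeviCivita cov)
    (hM : IsWarpedProduct I₁ I₂ (B := M₁) (F := M₂) f)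
    (hφ : IsIsometricImmersion (I := I) (I₁.prod I₂) φ) (x : M₁ × M₂)
    (X Y : TangentSpace I₁ x.1)
    (h : secondFundamentalForm (I₁.prod I₂) cov φ x (liftLeft I₁ I₂ x X) (liftLeft I₁ I₂ x Y) = 0) :
    secondFundamentalForm I₁ cov (fun p => φ (p, x.2)) x.1 X Y = 0 := by
  obtain ⟨u, hu⟩ := exists_mfderiv_eq_of_secondFundamentalForm_eq_zero h
  obtain ⟨X', rfl⟩ := hM.exists_eq_liftLeft x u fun W => by
    rw [← hφ.isometric, hu, inner_covAlong_left_left_right hcov hM hφ]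
  simp only [secondFundamentalForm]
  rw [covAlong_leaf_left hφ.smooth, ← hu]
  simp only [normalPart, tangentialPart]
  rw [sub_eq_zero, eq_comm]
  refine Submodule.starProjection_eq_self_iff.2 ?_
  rw [tangentImage_leaf_left (hφ.smooth.mdifferentiable (by simp) x)]
  exact Submodule.mem_map_of_mem ⟨X', rfl⟩

/-- Leaves `{p} × M₂` on which `h` vanishes are totally umbilical, with normal curvature vector
`-∇ ln f`, as in the warped product. -/
theorem secondFundamentalForm_leaf_right (hcov : IsLeviCivita cov)
    (hM : IsWarpedProduct I₁ I₂ (B := M₁) (F := M₂) f)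
    (hφ : IsIsometricImmersion (I := I) (I₁.prod I₂) φ) (x : M₁ × M₂)
    (Z W : TangentSpace I₂ x.2)
    (h : secondFundamentalForm (I₁.prod I₂) cov φ x (liftRight I₁ I₂ x Z) (liftRight I₁ I₂ x W) = 0) :
    secondFundamentalForm I₂ cov (fun q => φ (x.1, q)) x.2 Z W
      = (inner ℝ (liftRight I₁ I₂ x Z) (liftRight I₁ I₂ x W) : ℝ) •
        -(mfderiv (I₁.prod I₂) I φ x
          (riemannianGradient (I₁.prod I₂) (fun y : M₁ × M₂ => Real.log (f y.1)) x)) := by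
  set t := riemannianGradient (I₁.prod I₂) (fun y : M₁ × M₂ => Real.log (f y.1)) x with ht
  set c : ℝ := inner ℝ (liftRight I₁ I₂ x Z) (liftRight I₁ I₂ x W) with hc
  obtain ⟨u, hu⟩ := exists_mfderiv_eq_of_secondFundamentalForm_eq_zero h
  -- Adding `⟨Z, W⟩ ∇ ln f` cancels the component tangent to the first factor.
  obtain ⟨W', hW'⟩ := hM.exists_eq_liftRight x (u + c • t) fun X => by
    rw [inner_add_left, real_inner_smul_left, ht, inner_riemannianGradient, ← hφ.isometric, hu,
      inner_covAlong_right_right_left hcov hM hφ]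
    ring
  have hu' : mfderiv (I₁.prod I₂) I φ x u = mfderiv (I₁.prod I₂) I φ x (liftRight I₁ I₂ x W')
      - c • mfderiv (I₁.prod I₂) I φ x t := by
    rw [← hW', map_add, map_smul, add_sub_cancel_right]
  have h1 : (tangentImage (I := I) I₂ (fun q => φ (x.1, q)) x.2).starProjection
      (mfderiv (I₁.prod I₂) I φ x t) = 0 :=
    (Submodule.starProjection_apply_eq_zero_iff _).2 (hM.mfderiv_gradient_mem_orthogonal hφ x)
  have h2 : (tangentImage (I := I) I₂ (fun q => φ (x.1, q)) x.2).starProjection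
      (mfderiv (I₁.prod I₂) I φ x (liftRight I₁ I₂ x W'))
      = mfderiv (I₁.prod I₂) I φ x (liftRight I₁ I₂ x W') := by
    refine Submodule.starProjection_eq_self_iff.2 ?_
    rw [tangentImage_leaf_right (hφ.smooth.mdifferentiable (by simp) x)]
    exact Submodule.mem_map_of_mem ⟨W', rfl⟩
  simp only [secondFundamentalForm]
  rw [covAlong_leaf_right hφ.smooth, ← hu, hu']
  simp only [normalPart, tangentialPart]
  rw [map_sub, map_smul, h1, h2, smul_zero, smul_neg]
  abel

end SecondFundamentalForm

end

theorem theorem5p2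
    -- the Kaehler manifold `N`, with Levi-Civita connection `cov` and complex structure `J`
    {E : Type*} [NormedAddCommGroup E] [NormedSpace ℝ E] [FiniteDimensional ℝ E]
    {N : Type*} [TopologicalSpace N] [ChartedSpace E N] [IsManifold 𝓘(ℝ, E) ∞ N]
    [RiemannianBundle (fun x : N => TangentSpace 𝓘(ℝ, E) x)]
    [IsContMDiffRiemannianBundle 𝓘(ℝ, E) ∞ E (fun x : N => TangentSpace 𝓘(ℝ, E) x)]
    (cov : CovariantDerivative 𝓘(ℝ, E) E (TangentSpace 𝓘(ℝ, E) : N → Type _))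
    (J : ∀ x : N, TangentSpace 𝓘(ℝ, E) x →L[ℝ] TangentSpace 𝓘(ℝ, E) x)
    (hN : IsKaehler cov J)
    -- the Riemannian manifolds `M_T` and `M_θ`
    {ET : Type*} [NormedAddCommGroup ET] [NormedSpace ℝ ET] [FiniteDimensional ℝ ET]
    {MT : Type*} [TopologicalSpace MT] [ChartedSpace ET MT] [IsManifold 𝓘(ℝ, ET) ∞ MT]
    [RiemannianBundle (fun p : MT => TangentSpace 𝓘(ℝ, ET) p)]
    [IsContMDiffRiemannianBundle 𝓘(ℝ, ET) ∞ ET (fun p : MT => TangentSpace 𝓘(ℝ, ET) p)]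
    {Eθ : Type*} [NormedAddCommGroup Eθ] [NormedSpace ℝ Eθ] [FiniteDimensional ℝ Eθ]
    {Mθ : Type*} [TopologicalSpace Mθ] [ChartedSpace Eθ Mθ] [IsManifold 𝓘(ℝ, Eθ) ∞ Mθ]
    [RiemannianBundle (fun q : Mθ => TangentSpace 𝓘(ℝ, Eθ) q)]
    [IsContMDiffRiemannianBundle 𝓘(ℝ, Eθ) ∞ Eθ (fun q : Mθ => TangentSpace 𝓘(ℝ, Eθ) q)]
    -- the non-trivial warped product `M = M_T ×_f M_θ`
    [RiemannianBundle
      (fun x : MT × Mθ => TangentSpace (𝓘(ℝ, ET).prod 𝓘(ℝ, Eθ)) x)]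
    (f : MT → ℝ)
    (hM : IsWarpedProduct 𝓘(ℝ, ET) 𝓘(ℝ, Eθ) (B := MT) (F := Mθ) f)
    (hf : ¬ ∃ c : ℝ, ∀ p, f p = c)
    -- the immersion of `M` in `N`, and the dimensions
    (φ : MT × Mθ → N)
    (hφ : IsIsometricImmersion (I := 𝓘(ℝ, E)) (𝓘(ℝ, ET).prod 𝓘(ℝ, Eθ)) φ)
    (m n : ℕ) (hm : Module.finrank ℝ ET = m) (hn : Module.finrank ℝ Eθ = n)
    (hdim : Module.finrank ℝ E = m + 2 * n)
    -- `M_T` is holomorphic and `M_θ` is proper pointwise slant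
    (hT : ∀ q : Mθ, IsHolomorphicSubmanifold 𝓘(ℝ, ET) J (fun p : MT => φ (p, q)))
    (θ : MT × Mθ → ℝ)
    (hθ : ∀ p : MT, IsProperPointwiseSlant 𝓘(ℝ, Eθ) J (fun q : Mθ => φ (p, q))
      (fun q => θ (p, q))) :
    (∀ x : MT × Mθ, Real.sin (θ x) ≠ 0 →
      2 * (n : ℝ) * ((1 / Real.sin (θ x)) ^ 2 + (Real.cos (θ x) / Real.sin (θ x)) ^ 2)
          * ‖riemannianGradient (𝓘(ℝ, ET).prod 𝓘(ℝ, Eθ))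
              (fun y : MT × Mθ => Real.log (f y.1)) x‖ ^ 2
        ≤ secondFundamentalFormNormSq (𝓘(ℝ, ET).prod 𝓘(ℝ, Eθ)) cov φ x) ∧
    ((∀ x : MT × Mθ, Real.sin (θ x) ≠ 0 ∧
        secondFundamentalFormNormSq (𝓘(ℝ, ET).prod 𝓘(ℝ, Eθ)) cov φ x
          = 2 * (n : ℝ) * ((1 / Real.sin (θ x)) ^ 2 + (Real.cos (θ x) / Real.sin (θ x)) ^ 2)
            * ‖riemannianGradient (𝓘(ℝ, ET).prod 𝓘(ℝ, Eθ))
                (fun y : MT × Mθ => Real.log (f y.1)) x‖ ^ 2) →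
      (∀ q : Mθ, IsTotallyGeodesicSubmanifold 𝓘(ℝ, ET) cov (fun p : MT => φ (p, q))) ∧
      (∀ p : MT, IsTotallyUmbilicalSubmanifold 𝓘(ℝ, Eθ) cov (fun q : Mθ => φ (p, q))) ∧
      IsMinimalSubmanifold (𝓘(ℝ, ET).prod 𝓘(ℝ, Eθ)) cov φ) := by
  have hpt := fun x => le_secondFundamentalFormNormSq hN hM hφ hT (fun p => (hθ p).slant) x
  simp only [hn, ← mul_assoc] at hpt
  refine ⟨fun x hs => (hpt x hs).1, fun h => ?_⟩
  have heq := fun x => (hpt x (h x).1).2 (h x).2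
  refine ⟨fun q p X Y => ?_, fun p q => ?_, fun x => (heq x).2.2⟩
  · exact secondFundamentalForm_leaf_left hN.leviCivita hM hφ (p, q) X Y ((heq (p, q)).1 X Y)
  · refine ⟨_, neg_mem (hM.mfderiv_gradient_mem_orthogonal hφ (p, q)), fun Z W => ?_⟩
    have hφx := hφ.smooth.mdifferentiable (by simp) (p, q)
    refine (secondFundamentalForm_leaf_right hN.leviCivita hM hφ (p, q) Z W
      ((heq (p, q)).2.1 Z W)).trans ?_
    rw [← hφ.isometric]
    congr 2
    · exact (mfderiv_comp_prodMk_right (x := (p, q)) hφx Z).symm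
    · exact (mfderiv_comp_prodMk_right (x := (p, q)) hφx W).symm
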